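/- Work over $\mathbb{Q}$. Let $\mathbf{Cat}\mathfrak{Lie}$ be the $\mathbb{Q}$-linear category underlying the PROP of the Lie operad: its objects are the natural numbers, and $\mathbf{Cat}\mathfrak{Lie}(m,n)=\bigoplus_{f}\bigotimes_{i=1}^n\mathfrak{Lie}(f^{-1}(i))$, the sum being over surjections $f:\{1,\dots,m\}\to\{1,\dots,n\}$. Equivalently, $\mathbf{Cat}\mathfrak{Lie}(m,n)$ is the part of $\mathsf{Lie}(x_1,\dots,x_m)^{\otimes n}$ that is multilinear in $x_1,\dots,x_m$, where $\mathsf{Lie}(x_1,\dots,x_m)$ is the free Lie algebra, and composition is given by substitution. For $z=z_1\otimes\cdots\otimes z_n$ in this tensor power and $X\in\mathsf{Lie}(x_1,\dots,x_m)$, put $z\cdot X=\sum_i z_1\otimes\cdots\otimes[z_i,X]\otimes\cdots\otimes z_n$; this extends to a right action of the free associative algebra on $x_1,\dots,x_m$. Let $\mu(n)=\sum_{i=1}^n x_1\otimes\cdots\otimes[x_i,x_{n+1}]\otimes\cdots\otimes x_n\in\mathbf{Cat}\mathfrak{Lie}(n+1,n)$. Let $\delta\mathbf{Cat}\mathfrak{Lie}$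 be the bimodule $(m,n)\mapsto\mathbf{Cat}\mathfrak{Lie}(m,n+1)$, with right action by composition and left action $\varphi\cdot z=(\varphi\boxplus 1)\circ z$. Let $\delta^{(1)}\mathbf{Cat}\mathfrak{Lie}(m,n)\subset\delta\mathbf{Cat}\mathfrak{Lie}(m,n)$ be the sum of the terms with $|f^{-1}(n+1)|=1$, which is stable under the left action. Let $\pi:\delta\mathbf{Cat}\mathfrak{Lie}\to\delta^{(1)}\mathbf{Cat}\mathfrak{Lie}$ be the map $z\otimes X\mapsto\sum_j (z\cdot u_j)\otimes x_j$, where $X=\sum_j u_jx_j$ in the free associative algebra. Let $\widetilde\mu^{(1)}:\delta^{(1)}\mathbf{Cat}\mathfrak{Lie}\to\mathbf{Cat}\mathfrak{Lie}$ be $y\mapsto\mu(n)\circ y$. **Theorem.** The map $\pi$ restricts to the identity on $\delta^{(1)}\mathbf{Cat}\mathfrak{Lie}$ and commutes with the left actions, and there is a unique right action of $\mathbf{Cat}\mathfrak{Lie}$ on $\delta^{(1)}\mathbf{Cat}\mathfrak{Lie}$ with which $\pi$ commutes, namely $y\cdot\psi=\pi(y\circ\psi)$. Form the square-zero extension $\mathbb{C}\mathfrak{Lie}=\mathbf{Cat}\mathfrak{Lie}\oplus\delta^{(1)}\mathbf{Cat}\mathfrak{Lie}[1]$,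 with objects the natural numbers, $\mathbf{Cat}\mathfrak{Lie}$ in homological degree $0$, $\delta^{(1)}\mathbf{Cat}\mathfrak{Lie}$ in homological degree $1$, and composition given by composition in $\mathbf{Cat}\mathfrak{Lie}$ and the left and right actions on $\delta^{(1)}\mathbf{Cat}\mathfrak{Lie}$, the composite of two elements of degree $1$ being zero. With the differential $\widetilde\mu^{(1)}$ it is a differential graded category over $\mathbb{Q}$. The inclusion of $\mathbf{Cat}\mathfrak{Lie}$ (a differential graded category concentrated in degree $0$, with zero differential) as the part of degree $0$ is a functor of differential graded categories. -/

import Mathlib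

open scoped TensorProduct

noncomputable section

/-! ## Differential graded categories -/

universe u v

/-- The data underlying a (homologically `ℕ`-graded) differential graded category over `k`, without
any axiom: total morphism modules, their homogeneous parts, a differential, identities and a
bilinear composition (`comp f g` is `f ∘ g`, i.e. first `g`, then `f`). -/
structure DGData (k : Type*) [CommRing k] where
  /-- objects -/
  Obj : Type u
  /-- total morphism modules -/
  Mor : Obj → Obj → Type v
  [addCommGroup : ∀ a b, AddCommGroup (Mor a b)]
  [module : ∀ a b, Module k (Mor a b)]
  /-- the morphisms of (homological) degree `p` -/
  deg : ∀ a b, ℕ → Submodule k (Mor a b)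
  /-- the differential -/
  d : ∀ a b, Mor a b →ₗ[k] Mor a b
  /-- identities -/
  one : ∀ a, Mor a a
  /-- composition -/
  comp : ∀ a b c, Mor b c →ₗ[k] Mor a b →ₗ[k] Mor a c

attribute [instance] DGData.addCommGroup DGData.module

/-- The axioms of a differential graded category: every morphism module is the direct sum of its
homogeneous parts, the differential makes it a chain complex, composition is associative, unital,
compatible with the grading, and a chain map out of the tensor product of complexes (the graded
Leibniz rule with Koszul sign). -/
structure IsDGCategory {k : Type*} [CommRing k] (C : DGData.{u, v} k) : Prop where
  isInternal : ∀ a b, DirectSum.IsInternal (C.deg a b)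
  d_mem : ∀ a b p (f : C.Mor a b), f ∈ C.deg a b (p + 1) → C.d a b f ∈ C.deg a b p
  d_deg_zero : ∀ a b (f : C.Mor a b), f ∈ C.deg a b 0 → C.d a b f = 0
  d_d : ∀ a b (f : C.Mor a b), C.d a b (C.d a b f) = 0
  one_mem : ∀ a, C.one a ∈ C.deg a a 0
  comp_mem : ∀ a b c p q (f : C.Mor b c) (g : C.Mor a b), f ∈ C.deg b c p → g ∈ C.deg a b q →
    C.comp a b c f g ∈ C.deg a c (p + q)
  one_comp : ∀ a b (f : C.Mor a b), C.comp a b b (C.one b) f = f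
  comp_one : ∀ a b (f : C.Mor a b), C.comp a a b f (C.one a) = f
  assoc : ∀ a b c e (f : C.Mor c e) (g : C.Mor b c) (h : C.Mor a b),
    C.comp a b e (C.comp b c e f g) h = C.comp a c e f (C.comp a b c g h)
  leibniz : ∀ a b c p (f : C.Mor b c) (g : C.Mor a b), f ∈ C.deg b c p →
    C.d a c (C.comp a b c f g) =
      C.comp a b c (C.d b c f) g + (-1 : k) ^ p • C.comp a b c f (C.d a b g)

/-- The data underlying a functor of differential graded categories. -/
structure DGFunctorData {k : Type*} [CommRing k] (C D : DGData.{u, v} k) where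
  /-- the map on objects -/
  obj : C.Obj → D.Obj
  /-- the maps on morphisms -/
  map : ∀ a b, C.Mor a b →ₗ[k] D.Mor (obj a) (obj b)

/-- The axioms of a functor of differential graded categories: compatibility with identities,
composition, degrees and differentials. -/
structure IsDGFunctor {k : Type*} [CommRing k] {C D : DGData.{u, v} k}
    (F : DGFunctorData C D) : Prop where
  map_one : ∀ a, F.map a a (C.one a) = D.one (F.obj a)
  map_comp : ∀ a b c (f : C.Mor b c) (g : C.Mor a b),
    F.map a c (C.comp a b c f g) = D.comp _ _ _ (F.map b c f) (F.map a b g)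
  map_mem : ∀ a b p (f : C.Mor a b), f ∈ C.deg a b p → F.map a b f ∈ D.deg _ _ p
  map_d : ∀ a b (f : C.Mor a b), F.map a b (C.d a b f) = D.d _ _ (F.map a b f)

/-! ## The Lie PROP -/

namespace LieProp

/-- The free Lie algebra `Lie(V)` over `ℚ` on `x_0, …, x_{m-1}`, for `V = ℚ^m`. -/
abbrev FL (m : ℕ) : Type := FreeLieAlgebra ℚ (Fin m)

/-- `Lie(V)^{⊗ n}` for `V = ℚ^m`. -/
abbrev FLT (m n : ℕ) : Type := ⨂[ℚ] _ : Fin n, FL m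

/-- The generator `x_j` of the free Lie algebra. -/
abbrev x {m : ℕ} (j : Fin m) : FL m := FreeLieAlgebra.of ℚ j

/-- The multiset of labels of the leaves of a planar binary tree. -/
def leaves {X : Type*} : FreeMagma X → Multiset X
  | .of a => {a}
  | .mul s t => leaves s + leaves t

/-- The iterated Lie bracket of elements `v j` along a planar binary tree with leaves labelled
by indices `j`. -/
def bracket {X L : Type*} [LieRing L] (v : X → L) : FreeMagma X → L
  | .of a => v a
  | .mul s t => ⁅bracket v s, bracket v t⁆

/-- `n` planar binary trees such that every label in `Fin m` occurs on exactly one leaf in total.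
(Such a forest determines the surjection `Fin m → Fin n` that sends a label to the tree in which
it occurs.) -/
def IsForest {m n : ℕ} (w : Fin n → FreeMagma (Fin m)) : Prop :=
  ∑ i, leaves (w i) = (Finset.univ : Finset (Fin m)).val

/-- The element of `Lie(V)^{⊗ n}` represented by a forest: the tensor product of its iterated
brackets in the generators. -/
def forest {m n : ℕ} (w : Fin n → FreeMagma (Fin m)) : FLT m n :=
  PiTensorProduct.tprod ℚ fun i => bracket x (w i)

/-- The morphisms `m ⟶ n` of `CatLie`: the multilinear part of `Lie(ℚ^m)^{⊗ n}`. Here `Lie(S)` is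
realized as the multilinear part of the free Lie algebra on `S`, and the sum over surjections
`f : Fin m → Fin n` of the tensor products over `i` of `Lie(f ⁻¹ {i})` is realized inside
`Lie(ℚ^m)^{⊗ n}`, the summand of `f` being spanned by the forests in which the leaves of the
`i`-th tree are labelled by `f ⁻¹ {i}`, each label being used once. -/
def CatLie (m n : ℕ) : Submodule ℚ (FLT m n) :=
  Submodule.span ℚ {z | ∃ w : Fin n → FreeMagma (Fin m), IsForest w ∧ forest w = z}

lemma forest_mem {m n : ℕ} {w : Fin n → FreeMagma (Fin m)} (hw : IsForest w) :
    forest w ∈ CatLie m n :=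
  Submodule.subset_span ⟨w, hw, rfl⟩

/-- The substitution `x_j ↦ v j`, applied to each tensor factor. -/
def subst {n m : ℕ} (t : ℕ) (v : Fin n → FL m) : FLT n t →ₗ[ℚ] FLT m t :=
  PiTensorProduct.map fun _ => (FreeLieAlgebra.lift ℚ v : FL n →ₗ⁅ℚ⁆ FL m).toLinearMap

lemma lift_bracket {n m : ℕ} (v : Fin n → FL m) (s : FreeMagma (Fin n)) :
    FreeLieAlgebra.lift ℚ v (bracket x s) = bracket v s := by
  induction s using FreeMagma.rec with
  | of a => simp [bracket]
  | mul s t hs ht => simp [bracket, hs, ht]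

lemma subst_forest {n m t : ℕ} (v : Fin n → FL m) (w : Fin t → FreeMagma (Fin n)) :
    subst t v (forest w) = PiTensorProduct.tprod ℚ fun i => bracket v (w i) := by
  simp only [subst, forest, PiTensorProduct.map_tprod]
  congr 1
  funext i
  exact lift_bracket v (w i)

lemma bracket_update_of_notMem {X L : Type*} [DecidableEq X] [LieRing L] (v : X → L) (j : X)
    (a : L) (s : FreeMagma X) (h : j ∉ leaves s) :
    bracket (Function.update v j a) s = bracket v s := by
  induction s using FreeMagma.rec with
  | of b =>
    have : b ≠ j := by rintro rfl; simp [leaves] at h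
    simp [bracket, this]
  | mul s t hs ht =>
    simp only [leaves, Multiset.mem_add, not_or] at h
    simp [bracket, hs h.1, ht h.2]

lemma bracket_update_of_count {X L : Type*} [DecidableEq X] [LieRing L] [LieAlgebra ℚ L]
    (v : X → L) (j : X) (s : FreeMagma X) (h : (leaves s).count j = 1) :
    ∃ F : L →ₗ[ℚ] L, ∀ a, bracket (Function.update v j a) s = F a := by
  induction s using FreeMagma.rec with
  | of b =>
    have : b = j := by
      by_contra hb
      simp [leaves, Ne.symm hb] at h
    subst this
    exact ⟨LinearMap.id, fun a => by simp [bracket]⟩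
  | mul s t hs ht =>
    simp only [leaves, Multiset.count_add] at h
    rcases Nat.eq_zero_or_pos ((leaves s).count j) with h0 | h0
    · obtain ⟨F, hF⟩ := ht (by omega)
      refine ⟨(LieAlgebra.ad ℚ L (bracket v s)).comp F, fun a => ?_⟩
      simp [bracket, hF, bracket_update_of_notMem v j a s (Multiset.count_eq_zero.1 h0)]
    · obtain ⟨F, hF⟩ := hs (by omega)
      refine ⟨-(LieAlgebra.ad ℚ L (bracket v t)).comp F, fun a => ?_⟩
      simp [bracket, hF,
        bracket_update_of_notMem v j a t (Multiset.count_eq_zero.1 (by omega))]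

/-- Elements of `CatLie n t` depend linearly on each variable. -/
lemma subst_update {n m t : ℕ} (φ : FLT n t) (hφ : φ ∈ CatLie n t) (v : Fin n → FL m)
    (j : Fin n) :
    ∃ F : FL m →ₗ[ℚ] FLT m t, ∀ a, subst t (Function.update v j a) φ = F a := by
  induction hφ using Submodule.span_induction with
  | mem z hz =>
    obtain ⟨w, hw, rfl⟩ := hz
    have hc : ∑ i, (leaves (w i)).count j = 1 := by
      rw [← Multiset.count_sum', hw]
      exact Multiset.count_eq_one_of_mem Finset.univ.nodup (Finset.mem_univ j)
    obtain ⟨i₀, hi₀⟩ : ∃ i, (leaves (w i)).count j ≠ 0 := by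
      by_contra! hcon
      simp [hcon] at hc
    have hsplit := Finset.add_sum_erase Finset.univ (fun i => (leaves (w i)).count j)
      (Finset.mem_univ i₀)
    simp only [hc] at hsplit
    obtain ⟨F, hF⟩ := bracket_update_of_count v j (w i₀) (by omega)
    have hz : ∀ i, i ≠ i₀ → j ∉ leaves (w i) := by
      intro i hi
      have h0 : ∑ i ∈ Finset.univ.erase i₀, (leaves (w i)).count j = 0 := by omega
      exact Multiset.count_eq_zero.1
        (Finset.sum_eq_zero_iff.1 h0 i (Finset.mem_erase.2 ⟨hi, Finset.mem_univ i⟩))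
    refine ⟨((PiTensorProduct.tprod ℚ).toLinearMap (fun i => bracket v (w i)) i₀).comp F,
      fun a => ?_⟩
    rw [subst_forest]
    simp only [LinearMap.comp_apply, MultilinearMap.toLinearMap_apply]
    congr 1
    funext i
    by_cases hi : i = i₀
    · subst hi
      simp [hF]
    · simp [hi, bracket_update_of_notMem v j a (w i) (hz i hi)]
  | zero => exact ⟨0, fun a => by simp⟩
  | add y z _ _ hy hz =>
    obtain ⟨F, hF⟩ := hy
    obtain ⟨G, hG⟩ := hz
    exact ⟨F + G, fun a => by simp [hF, hG]⟩
  | smul c y _ hy =>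
    obtain ⟨F, hF⟩ := hy
    exact ⟨c • F, fun a => by simp [hF]⟩

/-- A morphism `φ : n ⟶ t` of `CatLie`, as a multilinear operation
`Lie(V)^n → Lie(V)^{⊗ t}`, by substitution. -/
def operation {n t : ℕ} (m : ℕ) (φ : CatLie n t) :
    MultilinearMap ℚ (fun _ : Fin n => FL m) (FLT m t) where
  toFun v := subst t v (φ : FLT n t)
  map_update_add' := by
    intro inst v j a b
    rw [Subsingleton.elim inst (instDecidableEqFin n)]
    obtain ⟨F, hF⟩ := subst_update (m := m) (φ : FLT n t) φ.2 v j
    simp [hF]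
  map_update_smul' := by
    intro inst v j c a
    rw [Subsingleton.elim inst (instDecidableEqFin n)]
    obtain ⟨F, hF⟩ := subst_update (m := m) (φ : FLT n t) φ.2 v j
    simp [hF]

/-- The operation of `CatLie n t` on the tensor powers of `Lie(V)`: the linear map
`Lie(V)^{⊗ n} → Lie(V)^{⊗ t}` with `v_0 ⊗ … ⊗ v_{n-1} ↦ φ(v_0, …, v_{n-1})`. -/
def op (m n t : ℕ) : CatLie n t →ₗ[ℚ] FLT m n →ₗ[ℚ] FLT m t where
  toFun φ := PiTensorProduct.lift (operation m φ)
  map_add' φ ψ := by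
    rw [← map_add]; congr 1; ext v; simp [operation]
  map_smul' c φ := by
    rw [RingHom.id_apply, ← map_smul]; congr 1; ext v; simp [operation]

lemma op_tprod {m n t : ℕ} (φ : CatLie n t) (v : Fin n → FL m) :
    op m n t φ (PiTensorProduct.tprod ℚ v) = subst t v φ := by
  simp [op, operation]

/-- Grafting of trees. -/
def graft {X Y : Type*} (v : X → FreeMagma Y) : FreeMagma X → FreeMagma Y
  | .of a => v a
  | .mul s t => .mul (graft v s) (graft v t)

lemma leaves_graft {X Y : Type*} (v : X → FreeMagma Y) (s : FreeMagma X) :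
    leaves (graft v s) = ((leaves s).map fun a => leaves (v a)).sum := by
  induction s using FreeMagma.rec with
  | of a => simp [graft, leaves]
  | mul s t hs ht => simp [graft, leaves, hs, ht]

lemma bracket_graft {X Y L : Type*} [LieRing L] (u : Y → L) (v : X → FreeMagma Y)
    (s : FreeMagma X) : bracket u (graft v s) = bracket (fun a => bracket u (v a)) s := by
  induction s using FreeMagma.rec with
  | of a => simp [graft, bracket]
  | mul s t hs ht => simp [graft, bracket, hs, ht]

lemma sum_leaves_graft {m n t : ℕ} (w : Fin t → FreeMagma (Fin n)) (hw : IsForest w)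
    (v : Fin n → FreeMagma (Fin m)) :
    ∑ i, leaves (graft v (w i)) = ∑ j, leaves (v j) := by
  simp only [leaves_graft]
  have h : ∀ i, ((leaves (w i)).map fun a => leaves (v a)).sum
      = Multiset.sumAddMonoidHom (Multiset.mapAddMonoidHom (fun a => leaves (v a))
        (leaves (w i))) := fun i => rfl
  simp only [h]
  rw [← map_sum, ← map_sum, hw]
  rfl

lemma op_forest {m n t : ℕ} {w : Fin t → FreeMagma (Fin n)} (hw : IsForest w)
    (v : Fin n → FreeMagma (Fin m)) :
    op m n t ⟨forest w, forest_mem hw⟩ (forest v) = forest fun i => graft v (w i) := by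
  have e := op_tprod (m := m) ⟨forest w, forest_mem hw⟩ fun j => bracket x (v j)
  refine e.trans ?_
  rw [subst_forest, forest]
  congr 1
  funext i
  exact (bracket_graft x v (w i)).symm

/-- The operation of `CatLie` restricts to spans of sets of forests closed under grafting. -/
lemma op_mem {m n t : ℕ} {P : (Fin n → FreeMagma (Fin m)) → Prop}
    {Q : (Fin t → FreeMagma (Fin m)) → Prop} {S : (Fin t → FreeMagma (Fin n)) → Prop}
    (hS : ∀ w, S w → IsForest w)
    (h : ∀ w v, S w → P v → Q fun i => graft v (w i))
    {φ : FLT n t} (hφ' : φ ∈ CatLie n t)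
    (hφ : φ ∈ Submodule.span ℚ {z | ∃ w, S w ∧ forest w = z})
    {ψ : FLT m n} (hψ : ψ ∈ Submodule.span ℚ {z | ∃ w, P w ∧ forest w = z}) :
    op m n t ⟨φ, hφ'⟩ ψ ∈ Submodule.span ℚ {z | ∃ w, Q w ∧ forest w = z} := by
  induction hφ using Submodule.span_induction with
  | mem z hz =>
    obtain ⟨w, hw, rfl⟩ := hz
    induction hψ using Submodule.span_induction with
    | mem z hz =>
      obtain ⟨v, hv, rfl⟩ := hz
      rw [op_forest (hS w hw)]
      exact Submodule.subset_span ⟨_, h w v hw hv, rfl⟩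
    | zero => simp
    | add y z _ _ hy hz => rw [map_add]; exact Submodule.add_mem _ hy hz
    | smul c y _ hy => rw [map_smul]; exact Submodule.smul_mem _ _ hy
  | zero =>
    have : (⟨0, hφ'⟩ : CatLie n t) = 0 := rfl
    simp [this]
  | add y z hy hz ihy ihz =>
    have hle : Submodule.span ℚ {z | ∃ w, S w ∧ forest w = z} ≤ CatLie n t :=
      Submodule.span_mono fun z ⟨w, hw, e⟩ => ⟨w, hS w hw, e⟩
    have : (⟨y + z, hφ'⟩ : CatLie n t) = ⟨y, hle hy⟩ + ⟨z, hle hz⟩ := rfl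
    rw [this, map_add]
    exact Submodule.add_mem _ (ihy _) (ihz _)
  | smul c y hy ihy =>
    have hle : Submodule.span ℚ {z | ∃ w, S w ∧ forest w = z} ≤ CatLie n t :=
      Submodule.span_mono fun z ⟨w, hw, e⟩ => ⟨w, hS w hw, e⟩
    have : (⟨c • y, hφ'⟩ : CatLie n t) = c • ⟨y, hle hy⟩ := rfl
    rw [this, map_smul]
    exact Submodule.smul_mem _ _ (ihy _)

lemma isForest_graft {m n t : ℕ} {w : Fin t → FreeMagma (Fin n)}
    {v : Fin n → FreeMagma (Fin m)} (hw : IsForest w) (hv : IsForest v) :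
    IsForest fun i => graft v (w i) := by
  unfold IsForest
  rw [sum_leaves_graft w hw v, hv]

/-- Composition in `CatLie` (`comp φ ψ` is `φ ∘ ψ`). -/
def comp (m n t : ℕ) : CatLie n t →ₗ[ℚ] CatLie m n →ₗ[ℚ] CatLie m t :=
  LinearMap.mk₂ ℚ
    (fun φ ψ => ⟨op m n t φ ψ, op_mem (fun _ h => h) (fun _ _ hw hv => isForest_graft hw hv)
      φ.2 φ.2 ψ.2⟩)
    (fun _ _ _ => Subtype.ext (by simp)) (fun _ _ _ => Subtype.ext (by simp))
    (fun _ _ _ => Subtype.ext (by simp)) (fun _ _ _ => Subtype.ext (by simp))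

lemma isForest_of (n : ℕ) : IsForest fun i : Fin n => FreeMagma.of i := by
  simp only [IsForest, leaves]
  exact Finset.sum_multiset_singleton _

/-- The identity `x_0 ⊗ … ⊗ x_{n-1}` of the object `n` in `CatLie`. -/
def one (n : ℕ) : CatLie n n := ⟨forest fun i => .of i, forest_mem (isForest_of n)⟩

/-! ## The functor `- ⊞ 1` and the elements `μ(n)` -/

/-- `Z ⊗ X ↦ Z ⊗ X`, as a bilinear map `Lie(V)^{⊗ n} × Lie(V) → Lie(V)^{⊗ (n+1)}`. -/
def snoc (m n : ℕ) : FLT m n →ₗ[ℚ] FL m →ₗ[ℚ] FLT m (n + 1) :=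
  PiTensorProduct.lift
    (MultilinearMap.curryRight
      (PiTensorProduct.tprod ℚ : MultilinearMap ℚ (fun _ : Fin (n + 1) => FL m) (FLT m (n + 1))))

lemma snoc_forest {m n : ℕ} (w : Fin n → FreeMagma (Fin m)) (s : FreeMagma (Fin m)) :
    snoc m n (forest w) (bracket x s) = forest (Fin.snoc (α := fun _ => FreeMagma (Fin m)) w s) := by
  simp only [snoc, forest, PiTensorProduct.lift.tprod, MultilinearMap.curryRight_apply]
  congr 1
  funext i
  refine Fin.lastCases ?_ (fun i => ?_) i <;> simp

/-- Relabelling `x_j ↦ x_{j}` from `n` to `n + 1` variables, followed by `- ⊗ x_n`. -/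
def boxOneAux (n t : ℕ) : FLT n t →ₗ[ℚ] FLT (n + 1) (t + 1) :=
  (snoc (n + 1) t).flip (x (Fin.last n)) ∘ₗ subst t fun j => x j.castSucc

/-- The forest `w ⊞ 1`. -/
def forestBoxOne {n t : ℕ} (w : Fin t → FreeMagma (Fin n)) : Fin (t + 1) → FreeMagma (Fin (n + 1)) :=
  Fin.snoc (α := fun _ => FreeMagma (Fin (n + 1)))
    (fun i => graft (fun j => .of j.castSucc) (w i)) (.of (Fin.last n))

lemma boxOneAux_forest {n t : ℕ} (w : Fin t → FreeMagma (Fin n)) :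
    boxOneAux n t (forest w) = forest (forestBoxOne w) := by
  have h : (subst t fun j : Fin n => x (m := n + 1) j.castSucc) (forest w)
      = forest fun i => graft (fun j => .of j.castSucc) (w i) := by
    rw [subst_forest, forest]
    congr 1
    funext i
    exact (bracket_graft x (fun j : Fin n => FreeMagma.of j.castSucc) (w i)).symm
  rw [boxOneAux, LinearMap.comp_apply, h, LinearMap.flip_apply]
  exact snoc_forest _ (.of (Fin.last n))

lemma isForest_boxOne {n t : ℕ} {w : Fin t → FreeMagma (Fin n)} (hw : IsForest w) :
    IsForest (forestBoxOne w) := by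
  have h1 := isForest_of (n + 1)
  unfold IsForest at h1 ⊢
  rw [Fin.sum_univ_castSucc] at h1 ⊢
  simp only [forestBoxOne, Fin.snoc_castSucc, Fin.snoc_last]
  rw [sum_leaves_graft w hw, h1]

/-- The linear map `- ⊞ 1 : CatLie n t → CatLie (n+1) (t+1)`, adding an identity strand on the right. -/
def boxOne (n t : ℕ) : CatLie n t →ₗ[ℚ] CatLie (n + 1) (t + 1) :=
  (boxOneAux n t).restrict fun z hz => by
    induction hz using Submodule.span_induction with
    | mem z hz =>
      obtain ⟨w, hw, rfl⟩ := hz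
      rw [boxOneAux_forest]
      exact forest_mem (isForest_boxOne hw)
    | zero => simp
    | add y z _ _ hy hz => rw [map_add]; exact Submodule.add_mem _ hy hz
    | smul c y _ hy => rw [map_smul]; exact Submodule.smul_mem _ _ hy

/-- The forest representing the bracket of the entries `i` and `n` of `n + 1`, placed in
position `i`. -/
def muForest {n : ℕ} (i : Fin n) : Fin n → FreeMagma (Fin (n + 1)) :=
  Function.update (fun k => .of k.castSucc) i (.mul (.of i.castSucc) (.of (Fin.last n)))

lemma sum_leaves_update {m n : ℕ} (w : Fin n → FreeMagma (Fin m)) (i : Fin n) (j : Fin m) :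
    ∑ k, leaves (Function.update w i (.mul (w i) (.of j)) k) = ∑ k, leaves (w k) + {j} := by
  rw [← Finset.add_sum_erase _ _ (Finset.mem_univ i),
    ← Finset.add_sum_erase _ (fun k => leaves (w k)) (Finset.mem_univ i)]
  have : ∀ k ∈ Finset.univ.erase i,
      leaves (Function.update w i (.mul (w i) (.of j)) k) = leaves (w k) := by
    intro k hk
    rw [Function.update_of_ne (Finset.ne_of_mem_erase hk)]
  rw [Finset.sum_congr rfl this]
  simp only [Function.update_self, leaves]
  abel

lemma isForest_mu {n : ℕ} (i : Fin n) : IsForest (muForest i) := by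
  have h1 := isForest_of (n + 1)
  unfold IsForest at h1 ⊢
  rw [Fin.sum_univ_castSucc] at h1
  rw [muForest, sum_leaves_update (fun k : Fin n => FreeMagma.of k.castSucc) i (Fin.last n), ← h1]
  rfl

/-- `μ(n) = ∑ i, x_0 ⊗ … ⊗ [x_i, x_n] ⊗ … ⊗ x_{n-1}` in `CatLie (n+1) n`
(in particular `μ(0) = 0`). -/
def mu (n : ℕ) : CatLie (n + 1) n :=
  ∑ i : Fin n, ⟨forest (muForest i), forest_mem (isForest_mu i)⟩

/-! ## The bimodule `δ⁽¹⁾ CatLie`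

The bimodule `δ CatLie` is `(m, n) ↦ CatLie m (n+1)`, where `φ : n ⟶ t` acts on the left by
composition with `φ ⊞ 1`, and where the right action is composition. -/

/-- `δ⁽¹⁾ CatLie (m, n) ⊆ CatLie m (n+1)`: the span of the forests whose last tree is a single
leaf, i.e. of the summands for which the fibre of the last element has cardinality one. -/
def DeltaOne (m n : ℕ) : Submodule ℚ (FLT m (n + 1)) :=
  Submodule.span ℚ {z | ∃ w : Fin (n + 1) → FreeMagma (Fin m),
    (IsForest w ∧ ∃ j, w (Fin.last n) = .of j) ∧ forest w = z}

lemma DeltaOne_le (m n : ℕ) : DeltaOne m n ≤ CatLie m (n + 1) :=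
  Submodule.span_mono fun _ ⟨w, hw, e⟩ => ⟨w, hw.1, e⟩

/-- The inclusion of `δ⁽¹⁾ CatLie` in `δ CatLie`. -/
def incl (m n : ℕ) : DeltaOne m n →ₗ[ℚ] CatLie m (n + 1) := Submodule.inclusion (DeltaOne_le m n)

/-- The left action of `CatLie` on `δ CatLie`: `φ · z = (φ ⊞ 1) ∘ z`. -/
def shiftLeft (m n t : ℕ) : CatLie n t →ₗ[ℚ] CatLie m (n + 1) →ₗ[ℚ] CatLie m (t + 1) :=
  comp m (n + 1) (t + 1) ∘ₗ boxOne n t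

/-- The left action of `CatLie` on `δ⁽¹⁾ CatLie`: the restriction of that on `δ CatLie`. -/
def deltaOneLeft (m n t : ℕ) : CatLie n t →ₗ[ℚ] DeltaOne m n →ₗ[ℚ] DeltaOne m t :=
  LinearMap.mk₂ ℚ
    (fun φ y => ⟨shiftLeft m n t φ (incl m n y), by
      have hS : (boxOne n t φ : FLT (n + 1) (t + 1)) ∈
          Submodule.span ℚ {z | ∃ w : Fin (t + 1) → FreeMagma (Fin (n + 1)),
            (IsForest w ∧ w (Fin.last t) = .of (Fin.last n)) ∧ forest w = z} := by
        change boxOneAux n t φ ∈ _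
        obtain ⟨z, hz⟩ := φ
        induction hz using Submodule.span_induction with
        | mem z hz =>
          obtain ⟨w, hw, rfl⟩ := hz
          rw [boxOneAux_forest]
          exact Submodule.subset_span
            ⟨_, ⟨isForest_boxOne hw, by simp [forestBoxOne]⟩, rfl⟩
        | zero => simp
        | add y z _ _ hy hz => rw [map_add]; exact Submodule.add_mem _ hy hz
        | smul c y _ hy => rw [map_smul]; exact Submodule.smul_mem _ _ hy
      refine op_mem (fun w h => h.1) (fun w v hw hv => ?_) (boxOne n t φ).2 hS y.2
      refine ⟨isForest_graft hw.1 hv.1, ?_⟩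
      obtain ⟨j, hj⟩ := hv.2
      exact ⟨j, by simp only [hw.2]; exact hj⟩⟩)
    (fun _ _ _ => Subtype.ext (by simp)) (fun _ _ _ => Subtype.ext (by simp))
    (fun _ _ _ => Subtype.ext (by simp)) (fun _ _ _ => Subtype.ext (by simp))

/-! ### The retraction `π : δ CatLie → δ⁽¹⁾ CatLie` -/

/-- The right adjoint action of `x_j` on `Lie(V)^{⊗ n}`:
`z_0 ⊗ … ⊗ z_{n-1} ↦ ∑ i, z_0 ⊗ … ⊗ [z_i, x_j] ⊗ … ⊗ z_{n-1}`. -/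
def adR {m : ℕ} (n : ℕ) (j : Fin m) : FLT m n →ₗ[ℚ] FLT m n :=
  ∑ i : Fin n, PiTensorProduct.map
    (Function.update (fun _ => LinearMap.id) i (-(LieAlgebra.ad ℚ (FL m) (x j))))

/-- The right action on `Lie(V)^{⊗ n}` of the free associative algebra `T(V)` that extends the
adjoint action, combined with the isomorphism between the augmentation ideal of `T(V)` and
`T(V) ⊗ V` (splitting off the last letter): the word `x_{j_1} ⋯ x_{j_k}` with `k ≥ 1` gives the map
`Z ↦ (((Z · x_{j_1}) ⋯ ) · x_{j_{k-1}}) ⊗ x_{j_k}`, and the empty word gives zero. -/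
def piWord {m : ℕ} (n : ℕ) : List (Fin m) → (FLT m n →ₗ[ℚ] FLT m (n + 1))
  | [] => 0
  | [j] => (snoc m n).flip (x j)
  | j :: k :: l => piWord n (k :: l) ∘ₗ adR n j

/-- The linear extension of `piWord` to `T(V)`. -/
def piAss (m n : ℕ) : FreeAlgebra ℚ (Fin m) →ₗ[ℚ] FLT m n →ₗ[ℚ] FLT m (n + 1) :=
  (FreeAlgebra.basisFreeMonoid ℚ (Fin m)).constr ℚ fun l => piWord n l.toList

section

attribute [local instance] LieRing.ofAssociativeRing

/-- The canonical map from the free Lie algebra to the free associative algebra. -/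
def toAss (m : ℕ) : FL m →ₗ[ℚ] FreeAlgebra ℚ (Fin m) :=
  (FreeLieAlgebra.lift ℚ (FreeAlgebra.ι ℚ) : FL m →ₗ⁅ℚ⁆ FreeAlgebra ℚ (Fin m)).toLinearMap

lemma toAss_bracket_mem {m : ℕ} (s : FreeMagma (Fin m)) :
    toAss m (bracket x s) ∈ Submodule.span ℚ
      {a | ∃ l : FreeMonoid (Fin m), (l.toList : Multiset (Fin m)) = leaves s ∧
        FreeAlgebra.basisFreeMonoid ℚ (Fin m) l = a} := by
  have hb : ∀ l : FreeMonoid (Fin m), FreeAlgebra.basisFreeMonoid ℚ (Fin m) l =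
      FreeAlgebra.equivMonoidAlgebraFreeMonoid.symm (MonoidAlgebra.of ℚ _ l) := fun l => rfl
  induction s using FreeMagma.rec with
  | of j =>
    refine Submodule.subset_span ⟨FreeMonoid.of j, rfl, ?_⟩
    rw [hb]
    simp [toAss, bracket, FreeAlgebra.equivMonoidAlgebraFreeMonoid]
  | mul s t hs ht =>
    have key : ∀ (s t : FreeMagma (Fin m)) (a b : FreeAlgebra ℚ (Fin m)),
        a ∈ Submodule.span ℚ {a | ∃ l : FreeMonoid (Fin m),
          (l.toList : Multiset (Fin m)) = leaves s ∧
            FreeAlgebra.basisFreeMonoid ℚ (Fin m) l = a} →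
        b ∈ Submodule.span ℚ {a | ∃ l : FreeMonoid (Fin m),
          (l.toList : Multiset (Fin m)) = leaves t ∧
            FreeAlgebra.basisFreeMonoid ℚ (Fin m) l = a} →
        a * b ∈ Submodule.span ℚ {a | ∃ l : FreeMonoid (Fin m),
          (l.toList : Multiset (Fin m)) = leaves s + leaves t ∧
            FreeAlgebra.basisFreeMonoid ℚ (Fin m) l = a} := by
      intro s t a b ha hb'
      have := Submodule.mul_mem_mul ha hb'
      rw [Submodule.span_mul_span] at this
      refine Submodule.span_mono ?_ this
      rintro _ ⟨_, ⟨l, hl, rfl⟩, _, ⟨l', hl', rfl⟩, rfl⟩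
      refine ⟨l * l', ?_, ?_⟩
      · rw [FreeMonoid.toList_mul, ← Multiset.coe_add, hl, hl']
      · simp only [hb, map_mul]
    have e : toAss m (bracket x (.mul s t)) =
        toAss m (bracket x s) * toAss m (bracket x t)
          - toAss m (bracket x t) * toAss m (bracket x s) := by
      simp [toAss, bracket, LieRing.of_associative_ring_bracket]
    rw [e]
    refine Submodule.sub_mem _ (key s t _ _ hs ht) ?_
    have := key t s _ _ ht hs
    rw [add_comm (leaves t)] at this
    exact this

end

/-- The map `Lie(V)^{⊗ n} ⊗ Lie(V) → Lie(V)^{⊗ n} ⊗ V ⊆ Lie(V)^{⊗ n} ⊗ Lie(V)` underlying `π`. -/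
def piAux (m n : ℕ) : FLT m (n + 1) →ₗ[ℚ] FLT m (n + 1) :=
  PiTensorProduct.lift
    (MultilinearMap.uncurryRight (M := fun _ : Fin (n + 1) => FL m)
      (((piAss m n ∘ₗ toAss m).flip).compMultilinearMap (PiTensorProduct.tprod ℚ)))

lemma piAux_forest {m n : ℕ} (w : Fin (n + 1) → FreeMagma (Fin m)) :
    piAux m n (forest w) =
      piAss m n (toAss m (bracket x (w (Fin.last n)))) (forest fun i => w i.castSucc) := by
  simp only [piAux, forest, PiTensorProduct.lift.tprod, MultilinearMap.uncurryRight_apply]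
  rfl

lemma piAss_word {m n : ℕ} (l : FreeMonoid (Fin m)) :
    piAss m n (FreeAlgebra.basisFreeMonoid ℚ (Fin m) l) = piWord n l.toList :=
  Module.Basis.constr_basis _ _ _ _

lemma adR_forest {m n : ℕ} (j : Fin m) (w : Fin n → FreeMagma (Fin m)) :
    adR n j (forest w) = ∑ i, forest (Function.update w i (.mul (w i) (.of j))) := by
  simp only [adR, LinearMap.sum_apply, forest, PiTensorProduct.map_tprod]
  refine Finset.sum_congr rfl fun i _ => ?_
  congr 1
  funext k
  by_cases hk : k = i
  · subst hk
    simp [bracket]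
  · simp [hk]

lemma piWord_mem {m n : ℕ} (l : List (Fin m)) (w : Fin n → FreeMagma (Fin m))
    (h : ∑ i, leaves (w i) + (l : Multiset (Fin m)) = (Finset.univ : Finset (Fin m)).val) :
    piWord n l (forest w) ∈ DeltaOne m n := by
  induction l generalizing w with
  | nil => simp [piWord]
  | cons j l ih =>
    cases l with
    | nil =>
      simp only [piWord, LinearMap.flip_apply]
      refine Submodule.subset_span
        ⟨Fin.snoc (α := fun _ => FreeMagma (Fin m)) w (.of j), ⟨?_, j, by simp⟩,
          (snoc_forest w (.of j)).symm⟩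
      rw [IsForest, Fin.sum_univ_castSucc]
      simpa [leaves] using h
    | cons k l =>
      simp only [piWord, LinearMap.comp_apply, adR_forest, map_sum]
      refine Submodule.sum_mem _ fun i _ => ih _ ?_
      rw [sum_leaves_update, ← h, add_assoc]
      rfl

lemma piAux_mem {m n : ℕ} (z : FLT m (n + 1)) (hz : z ∈ CatLie m (n + 1)) :
    piAux m n z ∈ DeltaOne m n := by
  induction hz using Submodule.span_induction with
  | mem z hz =>
    obtain ⟨w, hw, rfl⟩ := hz
    rw [piAux_forest]
    have := toAss_bracket_mem (w (Fin.last n))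
    rw [IsForest, Fin.sum_univ_castSucc] at hw
    generalize toAss m (bracket x (w (Fin.last n))) = b at this
    induction this using Submodule.span_induction with
    | mem a ha =>
      obtain ⟨l, hl, rfl⟩ := ha
      rw [piAss_word]
      exact piWord_mem _ _ (by rw [hl, hw])
    | zero => simp
    | add y z _ _ hy hz => rw [map_add]; exact Submodule.add_mem _ hy hz
    | smul c y _ hy => rw [map_smul]; exact Submodule.smul_mem _ _ hy
  | zero => simp
  | add y z _ _ hy hz => rw [map_add]; exact Submodule.add_mem _ hy hz
  | smul c y _ hy => rw [map_smul]; exact Submodule.smul_mem _ _ hy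

/-- The retraction `π : δ CatLie → δ⁽¹⁾ CatLie`. -/
def proj (m n : ℕ) : CatLie m (n + 1) →ₗ[ℚ] DeltaOne m n :=
  (piAux m n).restrict fun z hz => piAux_mem z hz

/-- The right action of `CatLie` on `δ⁽¹⁾ CatLie`: act in `δ CatLie`, then apply `π`. -/
def deltaOneRight (m n t : ℕ) : DeltaOne n t →ₗ[ℚ] CatLie m n →ₗ[ℚ] DeltaOne m t :=
  LinearMap.compr₂ (comp m n (t + 1) ∘ₗ incl n t) (proj m t)

/-- The differential `μ̃⁽¹⁾ : δ⁽¹⁾ CatLie → CatLie`: the restriction of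
`μ̃ : δ CatLie → CatLie`, `z ↦ μ(n) ∘ z`. -/
def muTilde (m n : ℕ) : DeltaOne m n →ₗ[ℚ] CatLie m n :=
  comp m (n + 1) n (mu n) ∘ₗ incl m n

end LieProp

/-! ## The two differential graded categories -/

open LieProp in
/-- `CatLie`, with objects the natural numbers, all morphisms of degree zero and zero
differential. -/
def CatLieDG : DGData.{0, 0} ℚ where
  Obj := ℕ
  Mor m n := CatLie m n
  deg _ _ p := if p = 0 then ⊤ else ⊥
  d _ _ := 0
  one := one
  comp := comp

open LieProp in
/-- The square-zero extension `CatLie ⊕ δ⁽¹⁾ CatLie [1]`, with `CatLie` in degree zero and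
`δ⁽¹⁾ CatLie` in degree one: composition is
`(φ, y) ∘ (ψ, z) = (φ ∘ ψ, φ · z + y · ψ)`, and the differential is `(φ, y) ↦ (μ̃⁽¹⁾ y, 0)`. -/
def CCLie : DGData.{0, 0} ℚ where
  Obj := ℕ
  Mor m n := CatLie m n × DeltaOne m n
  deg m n p :=
    if p = 0 then LinearMap.range (LinearMap.inl ℚ (CatLie m n) (DeltaOne m n))
    else if p = 1 then LinearMap.range (LinearMap.inr ℚ (CatLie m n) (DeltaOne m n))
    else ⊥
  d m n := LinearMap.inl ℚ _ _ ∘ₗ muTilde m n ∘ₗ LinearMap.snd ℚ _ _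
  one n := (one n, 0)
  comp m n t :=
    LinearMap.mk₂ ℚ
      (fun f g => (comp m n t f.1 g.1, deltaOneLeft m n t f.1 g.2 + deltaOneRight m n t f.2 g.1))
      (fun _ _ _ => Prod.ext (by simp) (by simp; abel))
      (fun _ _ _ => Prod.ext (by simp) (by simp))
      (fun _ _ _ => Prod.ext (by simp) (by simp; abel))
      (fun _ _ _ => Prod.ext (by simp) (by simp))

open LieProp in
/-- The inclusion of `CatLie` as the degree zero part of the square-zero extension. -/
def inclCatLie : DGFunctorData CatLieDG CCLie where
  obj n := n
  map m n := LinearMap.inl ℚ (CatLie m n) (DeltaOne m n)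

end

namespace LieProp

noncomputable section

/-! ### Linear maps on tensor powers and on the free associative algebra -/

/-! A morphism `φ : n ⟶ t` acts by `op` as a linear map `Lie(V)^{⊗ n} → Lie(V)^{⊗ t}`, and
composites in `CatLie` are values of such maps. Every identity therefore becomes one between linear
maps, checked on pure tensors `Z ⊗ X`, forests, or products `a x_j` in `T(V)`, the free associative
algebra.

The right adjoint action of `Lie(V)` on `Lie(V)^{⊗ n}` extends to a right action `act` of `T(V)`,
and `π(Z ⊗ X)` is `piAss` of the image of `X` in `T(V)`, where `piAss (a x_j) Z = (Z · a) ⊗ x_j` and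
`piAss 1 = 0`. Four facts carry the proof.

(1) Operations commute with the adjoint action (`op_adj`), because bracketing with `X` is a
derivation and each variable occurs once. Hence they commute with `T(V)`; so `π` respects the left
actions, and `μ ∘ (φ ⊞ 1) = φ ∘ μ`.

(2) If `p` is a Lie element, `piAss (a p) Z = piAss p (Z · a)`: a factor `a` can be moved across the
tensor sign (`piAss_mul_toAss_bracket`). So applying `π` before substituting does not change `π` of
the result, and the right action descends along `π` (`proj_comp_proj`). It is unique because `π` is
a retraction, hence surjective.

(3) `μ` sends `piAss b Z` to `Z · b - ε(b) Z`, with `ε` the augmentation. Since `ε` vanishes on Lie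
elements, `μ̃ = μ̃⁽¹⁾ ∘ π`, and the differential is a map of bimodules.

(4) For two elements of degree one the Leibniz rule requires `d(y) · z = y · d(z)`
(`deltaOneLeft_muTilde`). This reduces to `π((Z ⊗ X) · x_k) = (Z · X) ⊗ x_k`: in `T(V)` one has `[X,
x_k] = X x_k - x_k X`, and by (2) the second term cancels `π((Z · x_k) ⊗ X)`. -/

lemma snoc_tprod {m n : ℕ} (v : Fin n → FL m) (X : FL m) :
    snoc m n (PiTensorProduct.tprod ℚ v) X =
      PiTensorProduct.tprod ℚ (Fin.snoc (α := fun _ => FL m) v X) := by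
  simp [snoc]

lemma tprod_eq_snoc {m n : ℕ} (v : Fin (n + 1) → FL m) :
    PiTensorProduct.tprod ℚ v =
      snoc m n (PiTensorProduct.tprod ℚ fun i => v i.castSucc) (v (Fin.last n)) := by
  rw [snoc_tprod]
  congr 1
  exact (Fin.snoc_init_self v).symm

/-- Linear maps out of a tensor power are determined by their values on pure tensors. -/
lemma tprod_ext {m n : ℕ} {M : Type*} [AddCommGroup M] [Module ℚ M] {f g : FLT m n →ₗ[ℚ] M}
    (h : ∀ v, f (PiTensorProduct.tprod ℚ v) = g (PiTensorProduct.tprod ℚ v)) : f = g :=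
  PiTensorProduct.ext (MultilinearMap.ext h)

lemma snoc_ext {m n : ℕ} {M : Type*} [AddCommGroup M] [Module ℚ M]
    {f g : FLT m (n + 1) →ₗ[ℚ] M} (h : ∀ Z X, f (snoc m n Z X) = g (snoc m n Z X)) : f = g :=
  tprod_ext fun v => by rw [tprod_eq_snoc]; exact h _ _

lemma catLie_ext {m n : ℕ} {M : Type*} [AddCommGroup M] [Module ℚ M]
    {f g : CatLie m n →ₗ[ℚ] M}
    (h : ∀ w (hw : IsForest w), f ⟨forest w, forest_mem hw⟩ = g ⟨forest w, forest_mem hw⟩) :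
    f = g := by
  ext ⟨z, hz⟩
  induction hz using Submodule.span_induction with
  | mem z hz => obtain ⟨w, hw, rfl⟩ := hz; exact h w hw
  | zero => exact (map_zero f).trans (map_zero g).symm
  | add y z hy hz ihy ihz =>
    have e : (⟨y + z, Submodule.add_mem _ hy hz⟩ : CatLie m n) = ⟨y, hy⟩ + ⟨z, hz⟩ := rfl
    rw [e, map_add, map_add, ihy, ihz]
  | smul c y hy ihy =>
    have e : (⟨c • y, Submodule.smul_mem _ c hy⟩ : CatLie m n) = c • ⟨y, hy⟩ := rfl
    rw [e, map_smul, map_smul, ihy]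

lemma deltaOne_ext {m n : ℕ} {M : Type*} [AddCommGroup M] [Module ℚ M]
    {f g : DeltaOne m n →ₗ[ℚ] M}
    (h : ∀ w (hw : IsForest w ∧ ∃ j, w (Fin.last n) = .of j),
      f ⟨forest w, Submodule.subset_span ⟨w, hw, rfl⟩⟩ =
        g ⟨forest w, Submodule.subset_span ⟨w, hw, rfl⟩⟩) :
    f = g := by
  ext ⟨z, hz⟩
  induction hz using Submodule.span_induction with
  | mem z hz => obtain ⟨w, hw, rfl⟩ := hz; exact h w hw
  | zero => exact (map_zero f).trans (map_zero g).symm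
  | add y z hy hz ihy ihz =>
    have e : (⟨y + z, Submodule.add_mem _ hy hz⟩ : DeltaOne m n) = ⟨y, hy⟩ + ⟨z, hz⟩ := rfl
    rw [e, map_add, map_add, ihy, ihz]
  | smul c y hy ihy =>
    have e : (⟨c • y, Submodule.smul_mem _ c hy⟩ : DeltaOne m n) = c • ⟨y, hy⟩ := rfl
    rw [e, map_smul, map_smul, ihy]

/-! ### Words as a basis of the free associative algebra. -/

lemma basisFreeMonoid_eq {m : ℕ} (l : FreeMonoid (Fin m)) :
    FreeAlgebra.basisFreeMonoid ℚ (Fin m) l =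
      FreeAlgebra.equivMonoidAlgebraFreeMonoid.symm (MonoidAlgebra.of ℚ _ l) := rfl

lemma basisFreeMonoid_one {m : ℕ} : FreeAlgebra.basisFreeMonoid ℚ (Fin m) 1 = 1 := by
  rw [basisFreeMonoid_eq, map_one, map_one]

lemma basisFreeMonoid_mul {m : ℕ} (l l' : FreeMonoid (Fin m)) :
    FreeAlgebra.basisFreeMonoid ℚ (Fin m) (l * l') =
      FreeAlgebra.basisFreeMonoid ℚ (Fin m) l * FreeAlgebra.basisFreeMonoid ℚ (Fin m) l' := by
  simp only [basisFreeMonoid_eq, map_mul]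

lemma basisFreeMonoid_of {m : ℕ} (j : Fin m) :
    FreeAlgebra.basisFreeMonoid ℚ (Fin m) (FreeMonoid.of j) = FreeAlgebra.ι ℚ j := by
  rw [basisFreeMonoid_eq]
  simp [FreeAlgebra.equivMonoidAlgebraFreeMonoid]

/-- Linear maps out of the free associative algebra are determined by their values on `1` and on
products ending in a generator. -/
lemma freeAlgebra_ext {m : ℕ} {M : Type*} [AddCommGroup M] [Module ℚ M]
    {f g : FreeAlgebra ℚ (Fin m) →ₗ[ℚ] M} (h1 : f 1 = g 1)
    (h : ∀ a j, f (a * FreeAlgebra.ι ℚ j) = g (a * FreeAlgebra.ι ℚ j)) : f = g := by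
  refine (FreeAlgebra.basisFreeMonoid ℚ (Fin m)).ext fun l => ?_
  rcases List.eq_nil_or_concat l.toList with hl | ⟨l', j, hl⟩
  · have : l = 1 := hl
    rw [this, basisFreeMonoid_one, h1]
  · have : l = FreeMonoid.ofList l' * FreeMonoid.of j := by
      apply FreeMonoid.toList.injective
      rw [hl]
      simp
    rw [this, basisFreeMonoid_mul, basisFreeMonoid_of, h]

/-! ### The right action of the free associative algebra on tensor powers -/

/-- The action of an endomorphism on the `i`-th tensor factor. -/
def slot {m n : ℕ} (i : Fin n) : Module.End ℚ (FL m) →ₗ[ℚ] Module.End ℚ (FLT m n) :=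
  (PiTensorProduct.mapMultilinear ℚ (fun _ : Fin n => FL m) fun _ => FL m).toLinearMap
    (fun _ => LinearMap.id) i

lemma slot_eq {m n : ℕ} (i : Fin n) (A : Module.End ℚ (FL m)) :
    slot i A = PiTensorProduct.mapMonoidHom (R := ℚ) (s := fun _ : Fin n => FL m)
      (Pi.mulSingle i A) := rfl

lemma slot_mul {m n : ℕ} (i : Fin n) (A B : Module.End ℚ (FL m)) :
    (slot i (A * B) : Module.End ℚ (FLT m n)) = slot i A * slot i B := by
  simp only [slot_eq, Pi.mulSingle_mul, map_mul]

lemma slot_commute {m n : ℕ} {i k : Fin n} (h : i ≠ k) (A B : Module.End ℚ (FL m)) :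
    Commute (slot i A : Module.End ℚ (FLT m n)) (slot k B) := by
  simp only [slot_eq]
  exact (Pi.mulSingle_commute (f := fun _ : Fin n => Module.End ℚ (FL m)) h A B).map _

lemma slot_tprod {m n : ℕ} (i : Fin n) (A : Module.End ℚ (FL m)) (v : Fin n → FL m) :
    slot i A (PiTensorProduct.tprod ℚ v) =
      PiTensorProduct.tprod ℚ (Function.update v i (A (v i))) := by
  simp only [slot, MultilinearMap.toLinearMap_apply, PiTensorProduct.mapMultilinear_apply,
    PiTensorProduct.map_tprod]
  congr 1
  funext k
  by_cases hk : k = i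
  · subst hk; simp
  · simp [hk]

/-- The right adjoint action of `Lie(V)` on `Lie(V)^{⊗ n}`. -/
def adj {m : ℕ} (n : ℕ) (X : FL m) : Module.End ℚ (FLT m n) :=
  ∑ i : Fin n, slot i (-(LieAlgebra.ad ℚ (FL m) X))

lemma adj_x {m : ℕ} (n : ℕ) (j : Fin m) : adj n (x j) = adR n j := rfl

lemma adj_tprod {m n : ℕ} (X : FL m) (v : Fin n → FL m) :
    adj n X (PiTensorProduct.tprod ℚ v) =
      ∑ i, PiTensorProduct.tprod ℚ (Function.update v i ⁅v i, X⁆) := by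
  simp only [adj, LinearMap.sum_apply, slot_tprod]
  simp

/-- Distinct slots commute, so only the diagonal terms of the commutator survive. The order is
reversed because a right action is written with endomorphisms composed on the left. -/
lemma adj_lie {m : ℕ} (n : ℕ) (X Y : FL m) :
    adj n ⁅X, Y⁆ = adj n Y * adj n X - adj n X * adj n Y := by
  have h : ∀ i k : Fin n, ∀ A B : Module.End ℚ (FL m),
      (slot i A * slot k B - slot k B * slot i A : Module.End ℚ (FLT m n)) =
        if i = k then slot i (A * B - B * A) else 0 := by
    intro i k A B
    split_ifs with hik
    · subst hik
      rw [map_sub, slot_mul, slot_mul]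
    · rw [(slot_commute hik A B).eq, sub_self]
  simp only [adj, Finset.sum_mul_sum]
  -- Exchanging the summations in the second product pairs `slot i` of `Y` with `slot k` of `X` in
  -- both, so that the difference is a sum of commutators.
  rw [Finset.sum_comm (f := fun i k : Fin n =>
      (slot i (-(LieAlgebra.ad ℚ (FL m) X)) * slot k (-(LieAlgebra.ad ℚ (FL m) Y)) :
        Module.End ℚ (FLT m n))), ← Finset.sum_sub_distrib]
  simp only [← Finset.sum_sub_distrib, h, Finset.sum_ite_eq, Finset.mem_univ, if_true]
  refine Finset.sum_congr rfl fun i _ => ?_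
  congr 1
  ext Z
  simp

lemma adj_snoc {m n : ℕ} (X Y : FL m) (Z : FLT m n) :
    adj (n + 1) Y (snoc m n Z X) = snoc m n (adj n Y Z) X + snoc m n Z ⁅X, Y⁆ := by
  suffices h : adj (n + 1) Y ∘ₗ (snoc m n).flip X =
      (snoc m n).flip X ∘ₗ adj n Y + (snoc m n).flip ⁅X, Y⁆ from LinearMap.congr_fun h Z
  refine tprod_ext fun v => ?_
  simp only [LinearMap.comp_apply, LinearMap.add_apply, LinearMap.flip_apply, snoc_tprod,
    adj_tprod, map_sum, Fin.sum_univ_castSucc, Fin.snoc_castSucc,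
    Fin.snoc_last, Fin.update_snoc_last, Fin.snoc_update]

/-- The right action of the free associative algebra on `Lie(V)^{⊗ n}` that extends the right
adjoint action. -/
def act (m n : ℕ) : FreeAlgebra ℚ (Fin m) →ₗ[ℚ] Module.End ℚ (FLT m n) :=
  (MulOpposite.opLinearEquiv ℚ).symm.toLinearMap ∘ₗ
    (FreeAlgebra.lift ℚ fun j => MulOpposite.op (adR n j) :
      FreeAlgebra ℚ (Fin m) →ₐ[ℚ] (Module.End ℚ (FLT m n))ᵐᵒᵖ).toLinearMap

lemma act_one {m n : ℕ} : act m n 1 = 1 := by simp [act]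

lemma act_mul {m n : ℕ} (a b : FreeAlgebra ℚ (Fin m)) :
    act m n (a * b) = act m n b * act m n a := by simp [act]

lemma act_ι {m n : ℕ} (j : Fin m) : act m n (FreeAlgebra.ι ℚ j) = adR n j := by simp [act]

lemma toAss_x {m : ℕ} (j : Fin m) : toAss m (x j) = FreeAlgebra.ι ℚ j := by
  simp [toAss]

section

attribute [local instance] LieRing.ofAssociativeRing

lemma toAss_lie {m : ℕ} (X Y : FL m) :
    toAss m ⁅X, Y⁆ = toAss m X * toAss m Y - toAss m Y * toAss m X := by
  simp [toAss, LieRing.of_associative_ring_bracket]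

end

/-- Both sides agree on generators and turn a Lie bracket into the reversed commutator. -/
lemma act_toAss_bracket {m n : ℕ} (s : FreeMagma (Fin m)) :
    act m n (toAss m (bracket x s)) = adj n (bracket x s) := by
  induction s using FreeMagma.rec with
  | of j => simp only [bracket, toAss_x, act_ι, adj_x]
  | mul s t hs ht =>
    simp only [bracket, toAss_lie, map_sub, act_mul, hs, ht, adj_lie]

/-- The augmentation kills generators, and commutators because its target is commutative. -/
lemma algebraMapInv_toAss_bracket {m : ℕ} (s : FreeMagma (Fin m)) :
    FreeAlgebra.algebraMapInv (toAss m (bracket x s)) = 0 := by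
  induction s using FreeMagma.rec with
  | of j => simp [bracket, toAss_x, FreeAlgebra.algebraMapInv]
  | mul s t hs ht => simp [bracket, toAss_lie, hs, ht]

/-! ### Properties of `piAss` -/

lemma piAss_one {m n : ℕ} : piAss m n 1 = 0 := by
  rw [← basisFreeMonoid_one, piAss_word]
  rfl

/-- The recursion of `piWord` consumes letters from the left, while `π` is governed by the last
letter; this is the formula used from here on. -/
lemma piAss_mul_ι {m n : ℕ} (a : FreeAlgebra ℚ (Fin m)) (j : Fin m) (Z : FLT m n) :
    piAss m n (a * FreeAlgebra.ι ℚ j) Z = snoc m n (act m n a Z) (x j) := by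
  suffices h : piAss m n ∘ₗ LinearMap.mulRight ℚ (FreeAlgebra.ι ℚ j) =
      LinearMap.llcomp ℚ _ _ _ ((snoc m n).flip (x j)) ∘ₗ act m n from
    LinearMap.congr_fun (LinearMap.congr_fun h a) Z
  refine (FreeAlgebra.basisFreeMonoid ℚ (Fin m)).ext fun l => ?_
  simp only [LinearMap.comp_apply, LinearMap.mulRight_apply]
  rw [← basisFreeMonoid_of, ← basisFreeMonoid_mul, piAss_word]
  induction l using FreeMonoid.recOn with
  | one =>
    rw [basisFreeMonoid_one, act_one]
    rfl
  | of_mul k l ih =>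
    -- The word `l * j` is nonempty, so prefixing `k` falls under the third clause of `piWord`,
    -- which applies `adR n k` first.
    have hne : ∃ k' l', FreeMonoid.toList (l * FreeMonoid.of j) = k' :: l' :=
      List.exists_cons_of_ne_nil (by simp)
    obtain ⟨k', l', hl⟩ := hne
    rw [mul_assoc, FreeMonoid.toList_of_mul, hl]
    rw [hl] at ih
    rw [piWord, ih, basisFreeMonoid_mul, basisFreeMonoid_of, act_mul, act_ι]
    rfl

lemma piAss_ι {m n : ℕ} (j : Fin m) (Z : FLT m n) :
    piAss m n (FreeAlgebra.ι ℚ j) Z = snoc m n Z (x j) := by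
  have := piAss_mul_ι 1 j Z
  rwa [one_mul, act_one] at this

/-- For a generator this is `piAss_mul_ι`. The property passes to products `p q`, as `a p q` can be
read as `(a p) q`, hence to commutators. It would fail for the factor `1`, which `piAss` kills. -/
lemma piAss_mul_toAss_bracket {m n : ℕ} (a : FreeAlgebra ℚ (Fin m)) (s : FreeMagma (Fin m))
    (Z : FLT m n) :
    piAss m n (a * toAss m (bracket x s)) Z =
      piAss m n (toAss m (bracket x s)) (act m n a Z) := by
  induction s using FreeMagma.rec generalizing a Z with
  | of j => simp only [bracket, toAss_x, piAss_mul_ι, piAss_ι]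
  | mul s t hs ht =>
    simp only [bracket, toAss_lie, mul_sub, map_sub, LinearMap.sub_apply, ← mul_assoc, hs,
      ht, act_mul, Module.End.mul_apply]

lemma piAux_snoc {m n : ℕ} (Z : FLT m n) (X : FL m) :
    piAux m n (snoc m n Z X) = piAss m n (toAss m X) Z := by
  suffices h : piAux m n ∘ₗ (snoc m n).flip X = piAss m n (toAss m X) from
    LinearMap.congr_fun h Z
  refine tprod_ext fun v => ?_
  simp only [LinearMap.comp_apply, LinearMap.flip_apply, snoc_tprod, piAux,
    PiTensorProduct.lift.tprod, MultilinearMap.uncurryRight_apply, Fin.init_snoc, Fin.snoc_last]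
  rfl

/-! ### Naturality of the adjoint action -/

/-- The derivation rule for `⁅·, X⁆`, iterated down the tree. Distinct labels are needed because
`Function.update` alters every leaf with the given label. -/
lemma sum_bracket_update {m n : ℕ} (v : Fin n → FL m) (X : FL m) (s : FreeMagma (Fin n))
    (hs : (leaves s).Nodup) :
    ((leaves s).map fun i => bracket (Function.update v i ⁅v i, X⁆) s).sum = ⁅bracket v s, X⁆ := by
  induction s using FreeMagma.rec with
  | of a => simp [leaves, bracket]
  | mul s t ihs iht =>
    simp only [leaves, Multiset.nodup_add] at hs
    obtain ⟨h1, h2, h3⟩ := hs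
    have e1 : ((leaves s).map fun i => bracket (Function.update v i ⁅v i, X⁆) (s.mul t)).sum =
        ⁅⁅bracket v s, X⁆, bracket v t⁆ := by
      rw [← ihs h1]
      have e : ∀ a, ⁅a, bracket v t⁆ = (-(LieAlgebra.ad ℚ (FL m) (bracket v t))) a := by simp
      rw [e, map_multiset_sum, Multiset.map_map]
      refine congrArg _ (Multiset.map_congr rfl fun i hi => ?_)
      simp [bracket, bracket_update_of_notMem v i _ t (Multiset.disjoint_left.1 h3 hi)]
    have e2 : ((leaves t).map fun i => bracket (Function.update v i ⁅v i, X⁆) (s.mul t)).sum =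
        ⁅bracket v s, ⁅bracket v t, X⁆⁆ := by
      rw [← iht h2]
      refine Eq.trans ?_ (map_multiset_sum (LieAlgebra.ad ℚ (FL m) (bracket v s)) _).symm
      rw [Multiset.map_map]
      refine congrArg _ (Multiset.map_congr rfl fun i hi => ?_)
      simp [bracket, bracket_update_of_notMem v i _ s (Multiset.disjoint_right.1 h3 hi)]
    simp only [leaves, Multiset.map_add, Multiset.sum_add]
    rw [e1, e2, bracket, lie_lie (bracket v s) (bracket v t) X,
      ← lie_skew ⁅bracket v s, X⁆ (bracket v t)]
    abel

lemma IsForest.nodup {m n : ℕ} {w : Fin n → FreeMagma (Fin m)} (hw : IsForest w) (k : Fin n) :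
    (leaves (w k)).Nodup := by
  refine Multiset.nodup_of_le ?_ (Finset.univ : Finset (Fin m)).nodup
  rw [← hw]
  exact Finset.single_le_sum (f := fun i => leaves (w i)) (fun _ _ => Multiset.zero_le _)
    (Finset.mem_univ k)

lemma IsForest.notMem {m n : ℕ} {w : Fin n → FreeMagma (Fin m)} (hw : IsForest w) {k l : Fin n}
    (hkl : l ≠ k) {i : Fin m} (hi : i ∈ leaves (w k)) : i ∉ leaves (w l) := by
  have hn : (leaves (w k) + leaves (w l)).Nodup := by
    refine Multiset.nodup_of_le ?_ (Finset.univ : Finset (Fin m)).nodup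
    rw [← hw, ← Finset.sum_pair (f := fun i => leaves (w i)) hkl.symm]
    exact Finset.sum_le_sum_of_subset (Finset.subset_univ _)
  exact Multiset.disjoint_left.1 (Multiset.nodup_add.1 hn).2.2 hi

lemma IsForest.sum_eq {m n : ℕ} {w : Fin n → FreeMagma (Fin m)} (hw : IsForest w)
    {M : Type*} [AddCommMonoid M] (F : Fin m → M) :
    ∑ i, F i = ∑ k, ((leaves (w k)).map F).sum := by
  have h : ∀ k, ((leaves (w k)).map F).sum =
      Multiset.sumAddMonoidHom (Multiset.mapAddMonoidHom F (leaves (w k))) := fun _ => rfl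
  simp only [h]
  rw [← map_sum, ← map_sum, hw]
  rfl

/-- The operations of `CatLie` commute with the adjoint action. -/
lemma op_adj {m n t : ℕ} (φ : CatLie n t) (X : FL m) (Z : FLT m n) :
    op m n t φ (adj n X Z) = adj t X (op m n t φ Z) := by
  suffices h : op m n t φ ∘ₗ adj n X = adj t X ∘ₗ op m n t φ from LinearMap.congr_fun h Z
  refine tprod_ext fun v => ?_
  suffices h : (op m n t).flip (adj n X (PiTensorProduct.tprod ℚ v)) =
      adj t X ∘ₗ (op m n t).flip (PiTensorProduct.tprod ℚ v) from LinearMap.congr_fun h φ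
  refine catLie_ext fun w hw => ?_
  simp only [LinearMap.comp_apply, LinearMap.flip_apply, adj_tprod, map_sum,
    LinearMap.sum_apply, op_tprod, subst_forest]
  -- Each variable lies in exactly one tree: regroup the sum over variables by trees, then apply the
  -- derivation rule in each tree.
  refine (hw.sum_eq (M := FLT m t) _).trans ?_
  refine Finset.sum_congr rfl fun k _ => ?_
  rw [← sum_bracket_update v X (w k) (hw.nodup k)]
  refine Eq.trans ?_ (map_multiset_sum
    ((PiTensorProduct.tprod ℚ).toLinearMap (fun l => bracket v (w l)) k) _).symm
  rw [Multiset.map_map]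
  refine congrArg _ (Multiset.map_congr rfl fun i hi => ?_)
  simp only [Function.comp_apply, MultilinearMap.toLinearMap_apply]
  congr 1
  funext l
  by_cases hl : l = k
  · subst hl; simp
  · simp [hl, bracket_update_of_notMem v i _ (w l) (hw.notMem hl hi)]

lemma op_act {m n t : ℕ} (φ : CatLie n t) (a : FreeAlgebra ℚ (Fin m)) (Z : FLT m n) :
    op m n t φ (act m n a Z) = act m t a (op m n t φ Z) := by
  induction a using FreeAlgebra.induction generalizing Z with
  | grade0 r => simp [Algebra.algebraMap_eq_smul_one, act_one]
  | grade1 j => simp only [act_ι, ← adj_x, op_adj]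
  | mul a b ha hb => simp only [act_mul, Module.End.mul_apply, ha, hb]
  | add a b ha hb => simp only [map_add, LinearMap.add_apply, ha, hb]

lemma op_boxOne_snoc {m n t : ℕ} (φ : CatLie n t) (Z : FLT m n) (X : FL m) :
    op m (n + 1) (t + 1) (boxOne n t φ) (snoc m n Z X) = snoc m t (op m n t φ Z) X := by
  suffices h : op m (n + 1) (t + 1) (boxOne n t φ) ∘ₗ (snoc m n).flip X =
      (snoc m t).flip X ∘ₗ op m n t φ from LinearMap.congr_fun h Z
  refine tprod_ext fun v => ?_
  suffices h : (op m (n + 1) (t + 1)).flip (snoc m n (PiTensorProduct.tprod ℚ v) X) ∘ₗ boxOne n t =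
      (snoc m t).flip X ∘ₗ (op m n t).flip (PiTensorProduct.tprod ℚ v) from
    LinearMap.congr_fun h φ
  refine catLie_ext fun w hw => ?_
  have e : boxOne n t ⟨forest w, forest_mem hw⟩ =
      ⟨forest (forestBoxOne w), forest_mem (isForest_boxOne hw)⟩ :=
    Subtype.ext (boxOneAux_forest w)
  simp only [LinearMap.comp_apply, LinearMap.flip_apply, e, snoc_tprod, op_tprod, subst_forest]
  congr 1
  funext i
  refine Fin.lastCases ?_ (fun i => ?_) i
  · simp [forestBoxOne, bracket]
  · simp [forestBoxOne, bracket_graft, bracket]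

lemma op_boxOne_piAss {m n t : ℕ} (φ : CatLie n t) (b : FreeAlgebra ℚ (Fin m)) (Z : FLT m n) :
    op m (n + 1) (t + 1) (boxOne n t φ) (piAss m n b Z) = piAss m t b (op m n t φ Z) := by
  suffices h : op m (n + 1) (t + 1) (boxOne n t φ) ∘ₗ (piAss m n).flip Z =
      (piAss m t).flip (op m n t φ Z) from LinearMap.congr_fun h b
  refine freeAlgebra_ext ?_ fun a j => ?_
  · simp [piAss_one]
  · simp only [LinearMap.comp_apply, LinearMap.flip_apply, piAss_mul_ι, op_boxOne_snoc, op_act]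

lemma op_boxOne_piAux {m n t : ℕ} (φ : CatLie n t) (z : FLT m (n + 1)) :
    op m (n + 1) (t + 1) (boxOne n t φ) (piAux m n z) =
      piAux m t (op m (n + 1) (t + 1) (boxOne n t φ) z) := by
  suffices h : op m (n + 1) (t + 1) (boxOne n t φ) ∘ₗ piAux m n =
      piAux m t ∘ₗ op m (n + 1) (t + 1) (boxOne n t φ) from LinearMap.congr_fun h z
  refine snoc_ext fun Z X => ?_
  simp only [LinearMap.comp_apply, piAux_snoc, op_boxOne_piAss, op_boxOne_snoc]

/-! ### Substitution -/

/-- Substitution in the free associative algebra. -/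
def substAss {n m : ℕ} (v : Fin n → FL m) : FreeAlgebra ℚ (Fin n) →ₐ[ℚ] FreeAlgebra ℚ (Fin m) :=
  FreeAlgebra.lift ℚ fun j => toAss m (v j)

section

attribute [local instance] LieRing.ofAssociativeRing

lemma toAss_lift {n m : ℕ} (v : Fin n → FL m) (X : FL n) :
    toAss m (FreeLieAlgebra.lift ℚ v X) = substAss v (toAss n X) := by
  suffices h : ((FreeLieAlgebra.lift ℚ (FreeAlgebra.ι ℚ) : FL m →ₗ⁅ℚ⁆ FreeAlgebra ℚ (Fin m)).comp
        (FreeLieAlgebra.lift ℚ v)) =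
      (substAss v).toLieHom.comp (FreeLieAlgebra.lift ℚ (FreeAlgebra.ι ℚ)) from
    LieHom.congr_fun h X
  refine FreeLieAlgebra.hom_ext fun j => ?_
  simp [substAss, toAss]

end

lemma subst_tprod {n m t : ℕ} (v : Fin n → FL m) (u : Fin t → FL n) :
    subst t v (PiTensorProduct.tprod ℚ u) =
      PiTensorProduct.tprod ℚ fun i => FreeLieAlgebra.lift ℚ v (u i) :=
  PiTensorProduct.map_tprod _ _

lemma subst_snoc {n m t : ℕ} (v : Fin n → FL m) (Z : FLT n t) (X : FL n) :
    subst (t + 1) v (snoc n t Z X) = snoc m t (subst t v Z) (FreeLieAlgebra.lift ℚ v X) := by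
  suffices h : subst (t + 1) v ∘ₗ (snoc n t).flip X =
      (snoc m t).flip (FreeLieAlgebra.lift ℚ v X) ∘ₗ subst t v from LinearMap.congr_fun h Z
  refine tprod_ext fun u => ?_
  simp only [LinearMap.comp_apply, LinearMap.flip_apply, snoc_tprod, subst_tprod]
  congr 1
  funext i
  refine Fin.lastCases ?_ (fun i => ?_) i <;> simp

lemma subst_adj {n m t : ℕ} (v : Fin n → FL m) (X : FL n) (Z : FLT n t) :
    subst t v (adj t X Z) = adj t (FreeLieAlgebra.lift ℚ v X) (subst t v Z) := by
  suffices h : subst t v ∘ₗ adj t X = adj t (FreeLieAlgebra.lift ℚ v X) ∘ₗ subst t v from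
    LinearMap.congr_fun h Z
  refine tprod_ext fun u => ?_
  simp only [LinearMap.comp_apply, adj_tprod, map_sum, subst_tprod]
  refine Finset.sum_congr rfl fun i _ => ?_
  congr 1
  funext k
  by_cases hk : k = i
  · subst hk; simp
  · simp [hk]

/-- Taking the substituted elements to be brackets of trees allows `act_toAss_bracket`; this
suffices, since forests span `CatLie`. -/
lemma subst_act {n m t : ℕ} (v : Fin n → FreeMagma (Fin m)) (a : FreeAlgebra ℚ (Fin n))
    (Z : FLT n t) :
    subst t (fun j => bracket x (v j)) (act n t a Z) =
      act m t (substAss (fun j => bracket x (v j)) a) (subst t (fun j => bracket x (v j)) Z) := by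
  induction a using FreeAlgebra.induction generalizing Z with
  | grade0 r => simp [Algebra.algebraMap_eq_smul_one, act_one]
  | grade1 j =>
    simp only [act_ι, ← adj_x, subst_adj, substAss, FreeAlgebra.lift_ι_apply,
      act_toAss_bracket, FreeLieAlgebra.lift_of_apply]
  | mul a b ha hb => simp only [act_mul, map_mul, Module.End.mul_apply, ha, hb]
  | add a b ha hb => simp only [map_add, LinearMap.add_apply, ha, hb]

lemma piAux_subst_piAss {n m t : ℕ} (v : Fin n → FreeMagma (Fin m)) (b : FreeAlgebra ℚ (Fin n))
    (Z : FLT n t) :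
    piAux m t (subst (t + 1) (fun j => bracket x (v j)) (piAss n t b Z)) =
      piAss m t (substAss (fun j => bracket x (v j)) b)
        (subst t (fun j => bracket x (v j)) Z) := by
  suffices h : piAux m t ∘ₗ subst (t + 1) (fun j => bracket x (v j)) ∘ₗ (piAss n t).flip Z =
      (piAss m t).flip (subst t (fun j => bracket x (v j)) Z) ∘ₗ
        (substAss fun j => bracket x (v j)).toLinearMap from LinearMap.congr_fun h b
  refine freeAlgebra_ext ?_ fun a j => ?_
  · simp [piAss_one]
  · simp only [LinearMap.comp_apply, LinearMap.flip_apply, piAss_mul_ι, subst_snoc, piAux_snoc,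
      FreeLieAlgebra.lift_of_apply, AlgHom.toLinearMap_apply, map_mul, subst_act]
    -- After substitution the last letter `x_j` has become a Lie element, and the prefix is moved
    -- back across the tensor sign.
    rw [← piAss_mul_toAss_bracket, substAss, FreeAlgebra.lift_ι_apply]

/-- The kernel of `π` is stable under substitution. -/
lemma piAux_subst_piAux {n m t : ℕ} (v : Fin n → FreeMagma (Fin m)) (z : FLT n (t + 1)) :
    piAux m t (subst (t + 1) (fun j => bracket x (v j)) (piAux n t z)) =
      piAux m t (subst (t + 1) (fun j => bracket x (v j)) z) := by
  suffices h : piAux m t ∘ₗ subst (t + 1) (fun j => bracket x (v j)) ∘ₗ piAux n t =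
      piAux m t ∘ₗ subst (t + 1) (fun j => bracket x (v j)) from LinearMap.congr_fun h z
  refine snoc_ext fun Z X => ?_
  simp only [LinearMap.comp_apply, piAux_snoc, piAux_subst_piAss, subst_snoc, toAss_lift]

/-! ### The operation of `μ(n)` -/

lemma op_mu_snoc {m n : ℕ} (Z : FLT m n) (X : FL m) :
    op m (n + 1) n (mu n) (snoc m n Z X) = adj n X Z := by
  suffices h : op m (n + 1) n (mu n) ∘ₗ (snoc m n).flip X = adj n X from LinearMap.congr_fun h Z
  refine tprod_ext fun v => ?_
  simp only [LinearMap.comp_apply, LinearMap.flip_apply, snoc_tprod, adj_tprod, mu, map_sum,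
    LinearMap.sum_apply, op_tprod, subst_forest]
  refine Finset.sum_congr rfl fun i _ => ?_
  congr 1
  funext k
  by_cases hk : k = i
  · subst hk; simp [muForest, bracket]
  · simp [muForest, bracket, hk]

/-- On `a x_j` the augmentation vanishes and `μ` gives `Z · a x_j`; the correction term only
accounts for `piAss 1 = 0`. -/
lemma op_mu_piAss {m n : ℕ} (b : FreeAlgebra ℚ (Fin m)) (Z : FLT m n) :
    op m (n + 1) n (mu n) (piAss m n b Z) =
      act m n b Z - FreeAlgebra.algebraMapInv b • Z := by
  suffices h : op m (n + 1) n (mu n) ∘ₗ (piAss m n).flip Z =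
      (act m n).flip Z - (LinearMap.toSpanSingleton ℚ _ Z) ∘ₗ
        (FreeAlgebra.algebraMapInv (R := ℚ) (X := Fin m)).toLinearMap from
    LinearMap.congr_fun h b
  refine freeAlgebra_ext ?_ fun a j => ?_
  · simp [piAss_one, act_one]
  · simp [piAss_mul_ι, op_mu_snoc, act_mul, act_ι, adj_x, FreeAlgebra.algebraMapInv]

lemma forest_eq_snoc {m n : ℕ} (w : Fin (n + 1) → FreeMagma (Fin m)) :
    forest w = snoc m n (forest fun i => w i.castSucc) (bracket x (w (Fin.last n))) := by
  unfold forest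
  exact tprod_eq_snoc _

lemma op_mu_piAux_forest {m n : ℕ} (w : Fin (n + 1) → FreeMagma (Fin m)) :
    op m (n + 1) n (mu n) (piAux m n (forest w)) = op m (n + 1) n (mu n) (forest w) := by
  rw [piAux_forest, op_mu_piAss, act_toAss_bracket, algebraMapInv_toAss_bracket, zero_smul,
    sub_zero, ← op_mu_snoc]
  rw [← forest_eq_snoc]

lemma op_mu_boxOne {m n t : ℕ} (φ : CatLie n t) (z : FLT m (n + 1)) :
    op m (t + 1) t (mu t) (op m (n + 1) (t + 1) (boxOne n t φ) z) =
      op m n t φ (op m (n + 1) n (mu n) z) := by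
  suffices h : op m (t + 1) t (mu t) ∘ₗ op m (n + 1) (t + 1) (boxOne n t φ) =
      op m n t φ ∘ₗ op m (n + 1) n (mu n) from LinearMap.congr_fun h z
  refine snoc_ext fun Z X => ?_
  simp only [LinearMap.comp_apply, op_boxOne_snoc, op_mu_snoc, op_adj]

/-! ### Composition in `CatLie` and the bimodule structure of `δ⁽¹⁾ CatLie` -/

lemma graft_of {X : Type*} (s : FreeMagma X) : graft FreeMagma.of s = s := by
  induction s using FreeMagma.rec with
  | of a => rfl
  | mul s t hs ht => simp only [graft, hs, ht]

/-- On forests and pure tensors this is the compatibility of brackets with grafting; associativity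
of `comp` is the special case where `Z` is a morphism. -/
lemma op_comp {m n s t : ℕ} (φ : CatLie s t) (ψ : CatLie n s) (Z : FLT m n) :
    op m n t (comp n s t φ ψ) Z = op m s t φ (op m n s ψ Z) := by
  suffices h : op m n t (comp n s t φ ψ) = op m s t φ ∘ₗ op m n s ψ from LinearMap.congr_fun h Z
  refine tprod_ext fun v => ?_
  suffices h : (op m n t).flip (PiTensorProduct.tprod ℚ v) ∘ₗ (comp n s t).flip ψ =
      (op m s t).flip (op m n s ψ (PiTensorProduct.tprod ℚ v)) from LinearMap.congr_fun h φ
  refine catLie_ext fun w hw => ?_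
  suffices h : (op m n t).flip (PiTensorProduct.tprod ℚ v) ∘ₗ
        comp n s t ⟨forest w, forest_mem hw⟩ =
      op m s t ⟨forest w, forest_mem hw⟩ ∘ₗ (op m n s).flip (PiTensorProduct.tprod ℚ v) from
    LinearMap.congr_fun h ψ
  refine catLie_ext fun u hu => ?_
  have e : comp n s t ⟨forest w, forest_mem hw⟩ ⟨forest u, forest_mem hu⟩ =
      ⟨forest fun i => graft u (w i), forest_mem (isForest_graft hw hu)⟩ :=
    Subtype.ext (op_forest hw u)
  simp only [LinearMap.comp_apply, LinearMap.flip_apply, e, op_tprod, subst_forest, bracket_graft]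

lemma op_one {m n : ℕ} (Z : FLT m n) : op m n n (one n) Z = Z := by
  suffices h : op m n n (one n) = LinearMap.id from LinearMap.congr_fun h Z
  refine tprod_ext fun v => ?_
  simp only [one, op_tprod, subst_forest, bracket, LinearMap.id_apply]

lemma op_apply_one {n t : ℕ} (φ : CatLie n t) : op n n t φ (one n) = φ := by
  suffices h : (op n n t).flip (one n : FLT n n) = (CatLie n t).subtype from
    LinearMap.congr_fun h φ
  refine catLie_ext fun w hw => ?_
  refine (op_forest hw _).trans ?_
  simp only [graft_of, Submodule.subtype_apply]

lemma op_boxOne_comp {m n s t : ℕ} (φ : CatLie s t) (ψ : CatLie n s) (z : FLT m (n + 1)) :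
    op m (n + 1) (t + 1) (boxOne n t (comp n s t φ ψ)) z =
      op m (s + 1) (t + 1) (boxOne s t φ) (op m (n + 1) (s + 1) (boxOne n s ψ) z) := by
  suffices h : op m (n + 1) (t + 1) (boxOne n t (comp n s t φ ψ)) =
      op m (s + 1) (t + 1) (boxOne s t φ) ∘ₗ op m (n + 1) (s + 1) (boxOne n s ψ) from
    LinearMap.congr_fun h z
  refine snoc_ext fun Z X => ?_
  simp only [LinearMap.comp_apply, op_boxOne_snoc, op_comp]

lemma op_boxOne_one {m n : ℕ} (z : FLT m (n + 1)) :
    op m (n + 1) (n + 1) (boxOne n n (one n)) z = z := by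
  suffices h : op m (n + 1) (n + 1) (boxOne n n (one n)) = LinearMap.id from
    LinearMap.congr_fun h z
  refine snoc_ext fun Z X => ?_
  simp only [LinearMap.id_apply, op_boxOne_snoc, op_one]

lemma comp_assoc {a b c e : ℕ} (f : CatLie c e) (g : CatLie b c) (h : CatLie a b) :
    comp a b e (comp b c e f g) h = comp a c e f (comp a b c g h) :=
  Subtype.ext (op_comp (m := a) f g h)

lemma one_comp {a b : ℕ} (f : CatLie a b) : comp a b b (one b) f = f :=
  Subtype.ext (op_one _)

lemma comp_one {a b : ℕ} (f : CatLie a b) : comp a a b f (one a) = f :=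
  Subtype.ext (op_apply_one f)

lemma deltaOneLeft_comp {m n s t : ℕ} (φ : CatLie s t) (ψ : CatLie n s) (y : DeltaOne m n) :
    deltaOneLeft m n t (comp n s t φ ψ) y =
      deltaOneLeft m s t φ (deltaOneLeft m n s ψ y) :=
  Subtype.ext (op_boxOne_comp (m := m) φ ψ y)

lemma deltaOneLeft_one {m n : ℕ} (y : DeltaOne m n) : deltaOneLeft m n n (one n) y = y :=
  Subtype.ext (op_boxOne_one _)

lemma proj_incl {m n : ℕ} (y : DeltaOne m n) : proj m n (incl m n y) = y := by
  suffices h : proj m n ∘ₗ incl m n = LinearMap.id from LinearMap.congr_fun h y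
  refine deltaOne_ext fun w hw => Subtype.ext ?_
  obtain ⟨hw, j, hj⟩ := hw
  change piAux m n (forest w) = forest w
  rw [piAux_forest, forest_eq_snoc w, hj, bracket, toAss_x, piAss_ι]

lemma proj_shiftLeft {m n t : ℕ} (φ : CatLie n t) (z : CatLie m (n + 1)) :
    proj m t (shiftLeft m n t φ z) = deltaOneLeft m n t φ (proj m n z) :=
  Subtype.ext (op_boxOne_piAux (m := m) φ z).symm

/-- By linearity `ψ` may be a forest, and composing with it is substitution of brackets, so
`piAux_subst_piAux` applies. Associativity of the right action and its uniqueness follow from this.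
-/
lemma proj_comp_proj {m n t : ℕ} (z : CatLie n (t + 1)) (ψ : CatLie m n) :
    deltaOneRight m n t (proj n t z) ψ = proj m t (comp m n (t + 1) z ψ) := by
  suffices h : deltaOneRight m n t (proj n t z) = proj m t ∘ₗ comp m n (t + 1) z from
    LinearMap.congr_fun h ψ
  refine catLie_ext fun v hv => Subtype.ext ?_
  have e : ∀ z' : CatLie n (t + 1), op m n (t + 1) z' (forest v) =
      subst (t + 1) (fun j => bracket x (v j)) z' := fun z' => op_tprod _ _
  change piAux m t (op m n (t + 1) (incl n t (proj n t z)) (forest v)) =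
    piAux m t (op m n (t + 1) z (forest v))
  rw [e, e]
  exact piAux_subst_piAux (t := t) v z

lemma deltaOneRight_comp {a b c e : ℕ} (y : DeltaOne c e) (g : CatLie b c) (h : CatLie a b) :
    deltaOneRight a c e y (comp a b c g h) =
      deltaOneRight a b e (deltaOneRight b c e y g) h := by
  change _ = deltaOneRight a b e (proj b e (comp b c (e + 1) (incl c e y) g)) h
  rw [proj_comp_proj, comp_assoc]
  rfl

lemma deltaOneRight_one {m n : ℕ} (y : DeltaOne m n) : deltaOneRight m m n y (one m) = y := by
  change proj m n (comp m m (n + 1) (incl m n y) (one m)) = y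
  rw [comp_one, proj_incl]

lemma deltaOneLeft_deltaOneRight {a b c e : ℕ} (f : CatLie c e) (y : DeltaOne b c)
    (h : CatLie a b) :
    deltaOneRight a b e (deltaOneLeft b c e f y) h =
      deltaOneLeft a c e f (deltaOneRight a b c y h) := by
  change proj a e (comp a b (e + 1) (comp b (c + 1) (e + 1) (boxOne c e f) (incl b c y)) h) =
    deltaOneLeft a c e f (proj a c (comp a b (c + 1) (incl b c y) h))
  rw [comp_assoc, ← proj_shiftLeft]
  rfl

/-! ### The differential -/

/-- The formula of `op_mu_piAss` for a Lie element, whose augmentation is zero and whose action is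
the adjoint one. -/
lemma muTilde_proj {m n : ℕ} (z : CatLie m (n + 1)) :
    muTilde m n (proj m n z) = comp m (n + 1) n (mu n) z := by
  suffices h : muTilde m n ∘ₗ proj m n = comp m (n + 1) n (mu n) from LinearMap.congr_fun h z
  exact catLie_ext fun w hw => Subtype.ext (op_mu_piAux_forest w)

lemma muTilde_deltaOneLeft {m n t : ℕ} (φ : CatLie n t) (y : DeltaOne m n) :
    muTilde m t (deltaOneLeft m n t φ y) = comp m n t φ (muTilde m n y) :=
  Subtype.ext (op_mu_boxOne (m := m) φ y)

lemma muTilde_deltaOneRight {m n t : ℕ} (y : DeltaOne n t) (ψ : CatLie m n) :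
    muTilde m t (deltaOneRight m n t y ψ) = comp m n t (muTilde n t y) ψ := by
  refine (muTilde_proj (comp m n (t + 1) (incl n t y) ψ)).trans ?_
  rw [← comp_assoc]
  rfl

/-- Acting by `x_k` on the factor `Z` contributes `π((Z · x_k) ⊗ X)`, which cancels the term of `x_k
X` in `[X, x_k] = X x_k - x_k X`. -/
lemma piAux_adj_snoc {m n : ℕ} (Z : FLT m n) (s : FreeMagma (Fin m)) (k : Fin m) :
    piAux m n (adj (n + 1) (x k) (snoc m n Z (bracket x s))) =
      snoc m n (adj n (bracket x s) Z) (x k) := by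
  rw [adj_snoc, map_add, piAux_snoc, piAux_snoc, toAss_lie, toAss_x, map_sub,
    LinearMap.sub_apply, piAss_mul_ι, piAss_mul_toAss_bracket, act_toAss_bracket, act_ι, adj_x]
  abel

lemma deltaOneLeft_muTilde {m n t : ℕ} (y : DeltaOne n t) (z : DeltaOne m n) :
    deltaOneLeft m n t (muTilde n t y) z = deltaOneRight m n t y (muTilde m n z) := by
  suffices h : (deltaOneLeft m n t).flip z ∘ₗ muTilde n t =
      (deltaOneRight m n t).flip (muTilde m n z) from LinearMap.congr_fun h y
  refine deltaOne_ext fun u hu => ?_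
  obtain ⟨hu, j, hj⟩ := hu
  suffices h : deltaOneLeft m n t
        (muTilde n t ⟨forest u, Submodule.subset_span ⟨u, ⟨hu, j, hj⟩, rfl⟩⟩) =
      deltaOneRight m n t ⟨forest u, Submodule.subset_span ⟨u, ⟨hu, j, hj⟩, rfl⟩⟩ ∘ₗ
        muTilde m n from
    LinearMap.congr_fun h z
  refine deltaOne_ext fun w hw => Subtype.ext ?_
  obtain ⟨hw, k, hk⟩ := hw
  -- Dropping the last tree loses the label `k`, so this tensor is not a morphism from `m`; `op`
  -- still applies, being defined on the whole tensor power.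
  have e : ∀ {s : ℕ} (ψ : CatLie n s), op m n s ψ (forest fun i => w i.castSucc) =
      subst s (fun i => bracket x (w i.castSucc)) ψ := fun ψ => op_tprod ψ _
  have hmu : ((muTilde n t ⟨forest u, Submodule.subset_span ⟨u, ⟨hu, j, hj⟩, rfl⟩⟩ : CatLie n t) :
      FLT n t) = adj t (x j) (forest fun i => u i.castSucc) := by
    refine Eq.trans ?_ (op_mu_snoc _ _)
    change op n (t + 1) t (mu t) (forest u) = _
    rw [forest_eq_snoc u, hj, bracket]
  change op m (n + 1) (t + 1) (boxOne n t (muTilde n t _)) (forest w) =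
    piAux m t (op m n (t + 1) ⟨forest u, forest_mem hu⟩ (op m (n + 1) n (mu n) (forest w)))
  -- With `Z` the substituted first `t` factors of `u` and `X` the bracket substituted for `x_j`,
  -- the left side becomes `(Z · X) ⊗ x_k` and the right side `π((Z ⊗ X) · x_k)`.
  rw [forest_eq_snoc w, hk, bracket, op_boxOne_snoc, op_mu_snoc, op_adj, e, e, hmu, subst_adj]
  have hu' : subst (t + 1) (fun i => bracket x (w i.castSucc)) (forest u) =
      snoc m t (subst t (fun i => bracket x (w i.castSucc)) (forest fun i => u i.castSucc))
        (bracket x (w j.castSucc)) := by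
    rw [forest_eq_snoc u, hj, bracket, subst_snoc, FreeLieAlgebra.lift_of_apply]
  rw [FreeLieAlgebra.lift_of_apply, hu', piAux_adj_snoc]

/-! ### Gradings and the axioms of differential graded categories. -/

lemma isInternal_inl_inr (m n : ℕ) : DirectSum.IsInternal fun p : ℕ =>
    if p = 0 then LinearMap.range (LinearMap.inl ℚ (CatLie m n) (DeltaOne m n))
    else if p = 1 then LinearMap.range (LinearMap.inr ℚ (CatLie m n) (DeltaOne m n))
    else ⊥ := by
  rw [DirectSum.isInternal_submodule_iff_iSupIndep_and_iSup_eq_top]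
  constructor
  · intro p
    rcases p with _ | _ | p
    · simp only [if_true]
      refine LinearMap.disjoint_inl_inr.mono_right (iSup₂_le fun q hq => ?_)
      rw [if_neg hq]
      split_ifs <;> simp
    · simp only [zero_add, one_ne_zero, if_false, if_true]
      refine LinearMap.disjoint_inl_inr.symm.mono_right (iSup₂_le fun q hq => ?_)
      rw [if_neg hq]
      split_ifs <;> simp
    · simp
  · rw [eq_top_iff, ← LinearMap.sup_range_inl_inr]
    refine sup_le ?_ ?_
    · exact le_iSup_of_le 0 (by simp)
    · exact le_iSup_of_le 1 (by simp)

lemma isInternal_top (M : Type*) [AddCommGroup M] [Module ℚ M] :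
    DirectSum.IsInternal fun p : ℕ => if p = 0 then (⊤ : Submodule ℚ M) else ⊥ := by
  rw [DirectSum.isInternal_submodule_iff_iSupIndep_and_iSup_eq_top]
  constructor
  · intro p
    rcases p with _ | p
    · have : (⨆ q : ℕ, ⨆ _ : q ≠ 0, if q = 0 then (⊤ : Submodule ℚ M) else ⊥) = ⊥ := by
        simp only [iSup_eq_bot]
        exact fun q hq => if_neg hq
      rw [this]
      exact disjoint_bot_right
    · simp
  · rw [eq_top_iff]
    exact le_iSup_of_le 0 (by simp)

lemma mem_deg_catLieDG {m n p : ℕ} {f : CatLie m n} :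
    f ∈ CatLieDG.deg m n p ↔ p = 0 ∨ f = 0 := by
  change f ∈ (if p = 0 then (⊤ : Submodule ℚ (CatLie m n)) else ⊥) ↔ _
  split_ifs with h <;> simp [h]

/-- One condition per component, uniform in `p`, replaces the three cases of the grading in all the
degree arguments. -/
lemma mem_deg_ccLie {m n p : ℕ} {f : CatLie m n × DeltaOne m n} :
    f ∈ CCLie.deg m n p ↔ (p = 0 ∨ f.1 = 0) ∧ (p = 1 ∨ f.2 = 0) := by
  change f ∈ (if p = 0 then LinearMap.range (LinearMap.inl ℚ (CatLie m n) (DeltaOne m n))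
    else if p = 1 then LinearMap.range (LinearMap.inr ℚ (CatLie m n) (DeltaOne m n))
    else ⊥) ↔ _
  obtain ⟨φ, y⟩ := f
  rcases p with _ | _ | p
  · simp [LinearMap.mem_range, Prod.ext_iff, eq_comm]
  · simp [LinearMap.mem_range, Prod.ext_iff, eq_comm]
  · simp [Prod.ext_iff]

lemma isDGCategory_catLieDG : IsDGCategory CatLieDG where
  isInternal m n := isInternal_top (CatLie m n)
  d_mem _ _ _ _ _ := Submodule.zero_mem _
  d_deg_zero _ _ _ _ := rfl
  d_d _ _ _ := rfl
  one_mem _ := mem_deg_catLieDG.2 (Or.inl rfl)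
  comp_mem a b c p q f g hf hg := by
    refine mem_deg_catLieDG.2 ?_
    rcases mem_deg_catLieDG.1 hf with rfl | rfl
    · rcases mem_deg_catLieDG.1 hg with rfl | rfl
      · exact Or.inl rfl
      · exact Or.inr (map_zero (comp a b c f))
    · exact Or.inr (LinearMap.map_zero₂ (comp a b c) g)
  one_comp _ _ f := one_comp f
  comp_one _ _ f := comp_one f
  assoc _ _ _ _ f g h := comp_assoc f g h
  leibniz a b c p f g _ := by
    have key : ∀ (a b c p : ℕ) (f : CatLie b c) (g : CatLie a b),
        0 = comp a b c 0 g + (-1 : ℚ) ^ p • comp a b c f 0 := by simp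
    exact key a b c p f g

/-- Composition in `CatLie ⊕ δ⁽¹⁾ CatLie`. -/
def extComp {a b c : ℕ} (f : CatLie b c × DeltaOne b c) (g : CatLie a b × DeltaOne a b) :
    CatLie a c × DeltaOne a c :=
  (comp a b c f.1 g.1, deltaOneLeft a b c f.1 g.2 + deltaOneRight a b c f.2 g.1)

lemma extComp_mem {a b c p q : ℕ} {f : CatLie b c × DeltaOne b c} {g : CatLie a b × DeltaOne a b}
    (hf : (p = 0 ∨ f.1 = 0) ∧ (p = 1 ∨ f.2 = 0)) (hg : (q = 0 ∨ g.1 = 0) ∧ (q = 1 ∨ g.2 = 0)) :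
    (p + q = 0 ∨ (extComp f g).1 = 0) ∧ (p + q = 1 ∨ (extComp f g).2 = 0) := by
  obtain ⟨f₁, f₂⟩ := f
  obtain ⟨g₁, g₂⟩ := g
  obtain ⟨hf₁, hf₂⟩ := hf
  obtain ⟨hg₁, hg₂⟩ := hg
  dsimp only [extComp] at hf₁ hf₂ hg₁ hg₂ ⊢
  constructor
  · rcases hf₁ with rfl | rfl
    · rcases hg₁ with rfl | rfl
      · exact Or.inl rfl
      · simp
    · simp
  · rcases hf₁ with rfl | rfl
    · obtain rfl := hf₂.resolve_left zero_ne_one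
      rcases hg₂ with rfl | rfl <;> simp
    · rcases hf₂ with rfl | rfl
      · rcases hg₁ with rfl | rfl <;> simp
      · simp

lemma one_extComp {a b : ℕ} (f : CatLie a b × DeltaOne a b) : extComp (one b, 0) f = f := by
  simp only [extComp, one_comp, deltaOneLeft_one, LinearMap.map_zero₂, add_zero]

lemma extComp_one {a b : ℕ} (f : CatLie a b × DeltaOne a b) : extComp f (one a, 0) = f := by
  simp only [extComp, comp_one, deltaOneRight_one, map_zero, zero_add]

lemma extComp_assoc {a b c e : ℕ} (f : CatLie c e × DeltaOne c e) (g : CatLie b c × DeltaOne b c)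
    (h : CatLie a b × DeltaOne a b) : extComp (extComp f g) h = extComp f (extComp g h) := by
  simp only [extComp, comp_assoc, map_add, LinearMap.add_apply, deltaOneLeft_comp,
    deltaOneRight_comp, deltaOneLeft_deltaOneRight, add_assoc]

/-- The Leibniz rule in the square-zero extension. -/
lemma muTilde_extComp {a b c p : ℕ} {f : CatLie b c × DeltaOne b c}
    (g : CatLie a b × DeltaOne a b) (hf : (p = 0 ∨ f.1 = 0) ∧ (p = 1 ∨ f.2 = 0)) :
    (muTilde a c (extComp f g).2, (0 : DeltaOne a c)) =
      extComp (muTilde b c f.2, 0) g + (-1 : ℚ) ^ p • extComp f (muTilde a b g.2, 0) := by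
  obtain ⟨f₁, f₂⟩ := f
  obtain ⟨hf₁, hf₂⟩ := hf
  dsimp only at hf₁ hf₂
  -- The degree one parts of `d(f) g` and `f d(g)` both become `f₂ · d(g₂)`: they vanish for `p =
  -- 0`, where `f₂ = 0`, and cancel by the Koszul sign for `p = 1`.
  simp only [extComp, map_add, muTilde_deltaOneLeft, muTilde_deltaOneRight, deltaOneLeft_muTilde]
  rcases hf₁ with rfl | rfl
  · obtain rfl := hf₂.resolve_left zero_ne_one
    simp
  · rcases hf₂ with rfl | rfl
    · have h : ∀ y : DeltaOne a c, y + (-1 : ℚ) • y = 0 := fun y => by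
        have h' := add_smul (1 : ℚ) (-1) y
        rw [add_neg_cancel, zero_smul, one_smul] at h'
        exact h'.symm
      simp [h]
    · simp

lemma isDGCategory_ccLie : IsDGCategory CCLie where
  isInternal m n := isInternal_inl_inr m n
  d_mem a b p f hf := by
    refine mem_deg_ccLie.2 ⟨?_, Or.inr rfl⟩
    rcases (mem_deg_ccLie.1 hf).2 with hp | h
    · exact Or.inl (by omega)
    · right
      change muTilde a b f.2 = 0
      rw [h, map_zero]
  d_deg_zero a b f hf := by
    have h := (mem_deg_ccLie.1 hf).2.resolve_left zero_ne_one
    change (muTilde a b f.2, (0 : DeltaOne a b)) = 0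
    rw [h, map_zero]
    rfl
  d_d a b f := by
    change (muTilde a b 0, (0 : DeltaOne a b)) = 0
    rw [map_zero]
    rfl
  one_mem _ := mem_deg_ccLie.2 ⟨Or.inl rfl, Or.inr rfl⟩
  comp_mem _ _ _ _ _ _ _ hf hg :=
    mem_deg_ccLie.2 (extComp_mem (mem_deg_ccLie.1 hf) (mem_deg_ccLie.1 hg))
  one_comp _ _ f := one_extComp f
  comp_one _ _ f := extComp_one f
  assoc _ _ _ _ f g h := extComp_assoc f g h
  leibniz _ _ _ _ _ g hf := muTilde_extComp g (mem_deg_ccLie.1 hf)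

lemma isDGFunctor_inclCatLie : IsDGFunctor inclCatLie where
  map_one _ := rfl
  map_comp a b c f g := by
    have key : ∀ (a b c : ℕ) (f : CatLie b c) (g : CatLie a b),
        (comp a b c f g, (0 : DeltaOne a c)) = extComp (f, 0) (g, 0) := by simp [extComp]
    exact key a b c f g
  map_mem a b p f hf := mem_deg_ccLie.2 ⟨mem_deg_catLieDG.1 hf, Or.inr rfl⟩
  map_d a b f := by
    change ((0 : CatLie a b), (0 : DeltaOne a b)) = (muTilde a b 0, 0)
    rw [map_zero]

/-- Every `y` equals `π` of its inclusion, so compatibility with `π` determines all values of `R`.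
-/
lemma proj_comp_eq_iff (R : ∀ m n t : ℕ, DeltaOne n t →ₗ[ℚ] CatLie m n →ₗ[ℚ] DeltaOne m t) :
    (∀ (m n t : ℕ) (z : CatLie n (t + 1)) (ψ : CatLie m n),
      proj m t (comp m n (t + 1) z ψ) = R m n t (proj n t z) ψ) ↔ R = deltaOneRight := by
  constructor
  · intro h
    funext m n t
    refine LinearMap.ext fun y => LinearMap.ext fun ψ => ?_
    rw [← proj_incl y, ← h, proj_comp_proj]
  · rintro rfl m n t z ψ
    exact (proj_comp_proj z ψ).symm

end

end LieProp

theorem theoremA :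
    -- the projection `π` is the identity on `δ⁽¹⁾ CatLie` and compatible with the left actions
    (∀ (m n : ℕ) (y : LieProp.DeltaOne m n),
      LieProp.proj m n (LieProp.incl m n y) = y) ∧
    (∀ (m n t : ℕ) (φ : LieProp.CatLie n t) (z : LieProp.CatLie m (n + 1)),
      LieProp.proj m t (LieProp.shiftLeft m n t φ z) =
        LieProp.deltaOneLeft m n t φ (LieProp.proj m n z)) ∧
    -- the right action is the unique one for which `π` is compatible with the right actions
    (∀ R : ∀ m n t : ℕ, LieProp.DeltaOne n t →ₗ[ℚ] LieProp.CatLie m n →ₗ[ℚ] LieProp.DeltaOne m t,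
      (∀ (m n t : ℕ) (z : LieProp.CatLie n (t + 1)) (ψ : LieProp.CatLie m n),
        LieProp.proj m t (LieProp.comp m n (t + 1) z ψ) =
          R m n t (LieProp.proj n t z) ψ) ↔ R = LieProp.deltaOneRight) ∧
    -- the Lie PROP, in degree zero, and its square-zero extension are DG categories
    IsDGCategory CatLieDG ∧
    IsDGCategory CCLie ∧
    -- the inclusion is a DG functor
    IsDGFunctor inclCatLie := by
  exact ⟨fun _ _ => LieProp.proj_incl, fun _ _ _ => LieProp.proj_shiftLeft,
    LieProp.proj_comp_eq_iff, LieProp.isDGCategory_catLieDG, LieProp.isDGCategory_ccLie,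
    LieProp.isDGFunctor_inclCatLie⟩
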